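/- Let $K$ be an infinite field, let $n,d,r$ be integers with $d\ge 0$ and $n>d$, and suppose that $\operatorname{char} K=0$ or $\operatorname{char} K>n$. Let $R=K[x_1,\dots,x_n]$, let $R_d$ be the space of forms of degree $d$ in $R$ (including $0$), and let $P(i)$ denote the number of integer partitions of $i$ (so $P(0)=1$). Assume $1\le r\le P(d)$. The symmetric group $S_n$ acts on $R$ by $\sigma\cdot f(x_1,\dots,x_n)=f(x_{\sigma(1)},\dots,x_{\sigma(n)})$. For an $r$-dimensional linear subspace $L\subseteq R_d$, let $(L)_{S_n}$ be the ideal of $R$ generated by all $\sigma\cdot f$ with $\sigma\in S_n$ and $f\in L$. Let $\operatorname{Gr}_K(r,R_d)$ be the Grassmannian of $r$-dimensional linear subspaces of $R_d$, with the Zariski topology given by the Plücker embedding. Then there is a nonempty Zariski open set $U\subseteq \operatorname{Gr}_K(r,R_d)$ such that for every $L\in U$ the ideal $I=(L)_{S_n}$, with degree $d$ component $I_d=I\cap R_d$, satisfies $$\dim_K I_d=\dim_K R_d-(P(d)-r)\quad\Longleftrightarrow\quad n\ge 1+\frac{\sum_{i=0}^{d-1}P(i)}{r}.$$ -/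

import Mathlib

namespace SymIdeal

open MvPolynomial

/-- The exponent vectors of the monomials of degree `d` in `n` variables. -/
abbrev Exponent (n d : ℕ) : Type := {a : Fin n →₀ ℕ // a.degree = d}

/-- The Grassmannian `Gr_K(r, R_d)` of `r`-dimensional linear subspaces of the space `R_d` of
forms of degree `d` in `R = K[x_1, …, x_n]` (together with `0`). -/
structure FormGrassmannian (K : Type*) [Field K] (n r d : ℕ) where
  space : Submodule K (MvPolynomial (Fin n) K)
  le_forms : space ≤ homogeneousSubmodule (Fin n) K d
  finrank_eq : Module.finrank K space = r

/-- The Plücker coordinates of `r` forms of degree `d`: the `r × r` minors of the matrix whose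
`i`-th row lists the coefficients of `f i` in the basis of monomials of degree `d`. We index the
coordinates by all `r`-tuples `J` of monomials; up to sign, these are the coordinates with `J`
strictly increasing (for any ordering of the monomials), together with zeros. -/
def pluckerCoord {K : Type*} [Field K] {n r d : ℕ} (f : Fin r → MvPolynomial (Fin n) K)
    (J : Fin r → Exponent n d) : K :=
  Matrix.det (Matrix.of fun i j => coeff (J j).1 (f i))

/-- The points of the Grassmannian at which a polynomial `F` in the Plücker coordinates does not
vanish. For homogeneous `F` this does not depend on the basis `f` of the subspace, since a change
of basis multiplies all coordinates by the same nonzero scalar. -/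
def pluckerNonvanishing {K : Type*} [Field K] {n r d : ℕ}
    (F : MvPolynomial (Fin r → Exponent n d) K) : Set (FormGrassmannian K n r d) :=
  {L | ∃ f : Module.Basis (Fin r) K L.space,
    eval (pluckerCoord fun i => (f i : MvPolynomial (Fin n) K)) F ≠ 0}

/-- The Zariski topology of the Grassmannian, as a subvariety of projective space through the
Plücker embedding. -/
instance FormGrassmannian.zariskiTopology (K : Type*) [Field K] (n r d : ℕ) :
    TopologicalSpace (FormGrassmannian K n r d) :=
  TopologicalSpace.generateFrom
    {U | ∃ (k : ℕ) (F : MvPolynomial (Fin r → Exponent n d) K),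
      F.IsHomogeneous k ∧ U = pluckerNonvanishing F}

/-- The symmetric ideal `(L)_{S_n}`: the ideal generated by all `σ · f` for `f ∈ L` and
`σ ∈ S_n`, where `(σ · f)(x_1, …, x_n) = f(x_{σ(1)}, …, x_{σ(n)})`. -/
noncomputable def symmetricIdeal {K : Type*} [Field K] {n : ℕ} (L : Submodule K (MvPolynomial (Fin n) K)) :
    Ideal (MvPolynomial (Fin n) K) :=
  Ideal.span {g | ∃ σ : Equiv.Perm (Fin n), ∃ f ∈ L, g = rename σ f}

/-- A property holds for a general `(r, d)`-symmetric ideal if it holds for `(L)_{S_n}` for all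
`L` in some nonempty Zariski open subset of `Gr_K(r, R_d)`. -/
def HoldsForGeneral (K : Type*) [Field K] (n r d : ℕ)
    (P : Ideal (MvPolynomial (Fin n) K) → Prop) : Prop :=
  ∃ U : Set (FormGrassmannian K n r d), IsOpen U ∧ U.Nonempty ∧ ∀ L ∈ U, P (symmetricIdeal L.space)

/-- The graded component `I_d = I ∩ R_d`, as a `K`-vector space. -/
noncomputable def degreePart {K : Type*} [Field K] {n : ℕ} (I : Ideal (MvPolynomial (Fin n) K)) (d : ℕ) :
    Submodule K (MvPolynomial (Fin n) K) :=
  I.restrictScalars K ⊓ homogeneousSubmodule (Fin n) K d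

/-- The number `P(i)` of integer partitions of `i`. -/
def numPartitions (i : ℕ) : ℕ := Fintype.card (Nat.Partition i)

end SymIdeal

set_option linter.unusedSectionVars false

/-! Since `n!` is invertible in `K`, the representation `R_d` of `S_n` is semisimple. It is a
permutation module: each partition `m` of `d` contributes the module induced from the Young subgroup
`Y_m` stabilizing a monomial with exponents `m`. The space `I_d` is the subrepresentation generated
by `r` vectors spanning `L`.

Necessity (`finrank_orbitSpan_bounds`) holds for every `L`. The invariants of `I_d` are spanned by
`r` averages, while `R_d` has `P(d)` independent ones, so a stable complement has dimension at least
`P(d) - r`. If equality holds, compare the vectors fixed by a point stabilizer: `R_d` has at least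
`∑_{i<d} P(i) + P(d)` independent ones, `I_d` at most `n r`, the complement at most `P(d) - r`.
Hence `∑_{i<d} P(i) ≤ r (n - 1)`.

Sufficiency: a lower bound on `dim I_d` is an open condition in Plücker coordinates
(`exists_isOpen_le_finrank_degreePart`), so one good `L` is enough. By `exists_generators` and
Frobenius reciprocity it exists once `∑_m dim W^{Y_m} ≤ r dim W` for every nontrivial irreducible
`W` (`sum_finrank_fixedBy_le`). If `W` is the standard representation, `dim W^{Y_m}` is at most the
number `D` of distinct parts of `m`, these numbers add up to `∑_{i<d} P(i)`, and the hypothesis is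
exactly what is needed. Otherwise point stabilizers fix no nonzero vector of `W`, and `dim W^{Y_m} /
dim W` is at most `D / (n - 2)`, or `(D - 1) / (n - 3)` when `Y_m` fixes a point. Enough partitions
are of the second kind (`two_mul_sum_numPartitions_le_card`) for the same bound to follow. -/

namespace SymIdeal

/-! ### Semisimplicity: equivariant projections and reduction to irreducibles. -/

section Maschke

variable {K G E : Type*} [Field K] [Group G] [AddCommGroup E] [Module K E]

/-- A subspace is stable under a representation. -/
def Stable (ρ : Representation K G E) (W : Submodule K E) : Prop :=
  ∀ g, ∀ w ∈ W, ρ g w ∈ W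

/-- A stable subspace is irreducible as a representation. -/
def Irred (ρ : Representation K G E) (W : Submodule K E) : Prop :=
  Stable ρ W ∧ W ≠ ⊥ ∧ ∀ U ≤ W, Stable ρ U → U = ⊥ ∨ U = W

/-- A linear endomorphism commutes with the action. -/
def Equivariant (ρ : Representation K G E) (p : E →ₗ[K] E) : Prop :=
  ∀ g w, p (ρ g w) = ρ g (p w)

variable {ρ : Representation K G E}

lemma Stable.inf {A B : Submodule K E} (hA : Stable ρ A) (hB : Stable ρ B) :
    Stable ρ (A ⊓ B) := fun g w hw => ⟨hA g w hw.1, hB g w hw.2⟩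

lemma Equivariant.stable_ker {p : E →ₗ[K] E} (hp : Equivariant ρ p) :
    Stable ρ (LinearMap.ker p) := by
  intro g w hw
  rw [LinearMap.mem_ker] at hw ⊢
  rw [hp, hw, map_zero]

/-- Maschke's theorem in the form of an equivariant projection with prescribed image and
prescribed part of the kernel. -/
lemma exists_equivariant_projection [Fintype G] (hG : (Fintype.card G : K) ≠ 0)
    {A B : Submodule K E} (hA : Stable ρ A) (hB : Stable ρ B) (hAB : A ⊓ B = ⊥) :
    ∃ p : E →ₗ[K] E, Equivariant ρ p ∧ (∀ a ∈ A, p a = a) ∧ (∀ b ∈ B, p b = 0) ∧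
      ∀ w, p w ∈ A := by
  -- Project onto `A` along a complement containing `B`; averaging over `G` keeps the values on `A`
  -- and on `B`.
  obtain ⟨C, hBC, hCA⟩ := (disjoint_iff.2 hAB).symm.exists_isCompl
  let p₀ : E →ₗ[K] E := A.projection C hCA.symm
  have h1 : ∀ a ∈ A, p₀ a = a := fun a ha => Submodule.projection_apply_of_mem_left hCA.symm ha
  have h2 : ∀ b ∈ B, p₀ b = 0 := fun b hb =>
    (Submodule.projection_apply_eq_zero_iff hCA.symm).2 (hBC hb)
  have h3 : ∀ w, p₀ w ∈ A := fun w => Submodule.projection_apply_mem hCA.symm w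
  refine ⟨(Fintype.card G : K)⁻¹ • ∑ g : G, ρ g ∘ₗ p₀ ∘ₗ ρ g⁻¹, ?_, ?_, ?_, ?_⟩
  · intro h w
    simp only [LinearMap.smul_apply, LinearMap.sum_apply, LinearMap.comp_apply, map_smul, map_sum]
    congr 1
    rw [← Equiv.sum_comp (Equiv.mulLeft h)]
    refine Finset.sum_congr rfl fun g _ => ?_
    simp only [Equiv.coe_mulLeft, mul_inv_rev, map_mul, Module.End.mul_apply]
    congr 3
    rw [← Module.End.mul_apply (ρ h⁻¹), ← map_mul, inv_mul_cancel, map_one, Module.End.one_apply]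
  · intro a ha
    simp only [LinearMap.smul_apply, LinearMap.sum_apply, LinearMap.comp_apply]
    rw [Finset.sum_congr rfl (g := fun _ => a)]
    · rw [Finset.sum_const, Finset.card_univ, ← Nat.cast_smul_eq_nsmul K, smul_smul,
        inv_mul_cancel₀ hG, one_smul]
    · intro g _
      rw [h1 _ (hA _ _ ha), ← Module.End.mul_apply, ← map_mul, mul_inv_cancel, map_one,
        Module.End.one_apply]
  · intro b hb
    simp only [LinearMap.smul_apply, LinearMap.sum_apply, LinearMap.comp_apply]
    rw [Finset.sum_eq_zero, smul_zero]
    intro g _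
    rw [h2 _ (hB _ _ hb), map_zero]
  · intro w
    simp only [LinearMap.smul_apply, LinearMap.sum_apply, LinearMap.comp_apply]
    exact A.smul_mem _ (A.sum_mem fun g _ => hA _ _ (h3 _))

/-- Complements of stable subspaces. -/
lemma exists_stable_compl [Fintype G] (hG : (Fintype.card G : K) ≠ 0)
    {A N : Submodule K E} (hA : Stable ρ A) (hN : Stable ρ N) (hAN : A ≤ N) :
    ∃ U ≤ N, Stable ρ U ∧ A ⊓ U = ⊥ ∧ A ⊔ U = N := by
  obtain ⟨p, hp, h1, -, h3⟩ := exists_equivariant_projection (B := ⊥) hG hA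
    (fun g w hw => by simp_all) (by simp)
  refine ⟨N ⊓ LinearMap.ker p, inf_le_left, hN.inf hp.stable_ker, ?_, ?_⟩
  · rw [eq_bot_iff]
    rintro w ⟨hw, -, hw'⟩
    have hw' : p w = 0 := hw'
    rw [h1 w hw] at hw'
    simpa using hw'
  · refine le_antisymm (sup_le hAN inf_le_left) fun w hw => ?_
    refine Submodule.mem_sup.2 ⟨p w, h3 w, w - p w, ⟨N.sub_mem hw (hAN (h3 w)), ?_⟩, by abel⟩
    rw [SetLike.mem_coe, LinearMap.mem_ker, map_sub, h1 _ (h3 w), sub_self]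

lemma exists_irred_le [FiniteDimensional K E] {N : Submodule K E} (hN : Stable ρ N)
    (h0 : N ≠ ⊥) : ∃ W ≤ N, Irred ρ W := by
  induction hf : Module.finrank K N using Nat.strong_induction_on generalizing N with
  | _ m ih =>
    by_cases hI : ∀ U ≤ N, Stable ρ U → U = ⊥ ∨ U = N
    · exact ⟨N, le_rfl, hN, h0, hI⟩
    · push Not at hI
      obtain ⟨U, hU, hUs, hU0, hUN⟩ := hI
      obtain ⟨W, hW, hWI⟩ := ih _ (hf ▸ Submodule.finrank_lt_finrank_of_lt (lt_of_le_of_ne hU hUN))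
        hUs hU0 rfl
      exact ⟨W, hW.trans hU, hWI⟩

lemma finrank_sup_of_disjoint [FiniteDimensional K E] {A B : Submodule K E} (h : A ⊓ B = ⊥) :
    Module.finrank K ↥(A ⊔ B) = Module.finrank K A + Module.finrank K B := by
  have := Submodule.finrank_sup_add_finrank_inf_eq A B
  rwa [h, finrank_bot, add_zero] at this

/-- A linear inequality between the dimension of a representation and the dimension of the vectors
fixed by part of the group holds if it holds for irreducible subrepresentations. -/
lemma finrank_inf_le_of_irred [FiniteDimensional K E] [Fintype G]
    (hG : (Fintype.card G : K) ≠ 0) {F : Submodule K E}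
    (hF : ∀ A B, Stable ρ A → Stable ρ B → A ⊓ B = ⊥ → ∀ a ∈ A, ∀ b ∈ B, a + b ∈ F →
      a ∈ F ∧ b ∈ F) (p q : ℕ) {W : Submodule K E} (hW : Stable ρ W)
    (h : ∀ U ≤ W, Irred ρ U → p * Module.finrank K ↥(U ⊓ F) ≤ q * Module.finrank K U) :
    p * Module.finrank K ↥(W ⊓ F) ≤ q * Module.finrank K W := by
  induction hf : Module.finrank K W using Nat.strong_induction_on generalizing W with
  | _ m ih =>
    subst hf
    by_cases h0 : W = ⊥
    · subst h0; simp
    obtain ⟨A, hAW, hA⟩ := exists_irred_le hW h0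
    obtain ⟨U, hUW, hU, hAU, hAU'⟩ := exists_stable_compl hG hA.1 hW hAW
    have hA1 := h A hAW hA
    have hfin := finrank_sup_of_disjoint hAU
    rw [hAU'] at hfin
    have hApos : 0 < Module.finrank K A := by
      rw [Nat.pos_iff_ne_zero]
      intro h'
      exact hA.2.1 (Submodule.finrank_eq_zero.1 h')
    have hU1 := ih _ (by omega) hU (fun V hV => h V (hV.trans hUW)) rfl
    -- `hF` lets `F` split along `A ⊕ U`, so the left side of the inequality is subadditive and the
    -- right side additive.
    have hsub : W ⊓ F ≤ (A ⊓ F) ⊔ (U ⊓ F) := by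
      rintro w ⟨hw, hwF⟩
      rw [← hAU'] at hw
      obtain ⟨a, ha, b, hb, rfl⟩ := Submodule.mem_sup.1 hw
      obtain ⟨h1, h2⟩ := hF A U hA.1 hU hAU a ha b hb hwF
      exact Submodule.add_mem_sup ⟨ha, h1⟩ ⟨hb, h2⟩
    have h5 := (Submodule.finrank_mono hsub).trans (Submodule.finrank_add_le_finrank_add_finrank _ _)
    calc p * Module.finrank K ↥(W ⊓ F)
        ≤ p * (Module.finrank K ↥(A ⊓ F) + Module.finrank K ↥(U ⊓ F)) := Nat.mul_le_mul_left _ h5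
      _ ≤ q * Module.finrank K W := by rw [hfin]; nlinarith

end Maschke

end SymIdeal

namespace SymIdeal

/-! ### Recognizing the standard representation by a vector fixed by a point stabilizer. -/

section Standard

open Equiv

variable {K E Y : Type*} [Field K] [AddCommGroup E] [Module K E] [FiniteDimensional K E]
  [Fintype Y] [DecidableEq Y] {ρ : Representation K (Perm Y) E}

/-- The permutation `swap y₀ (σ x) * σ * swap y₀ x` fixes `y₀`. Thus the translates of `w` are
indexed by the points of `Y` and permuted like them. -/
lemma translate_apply {y₀ : Y} {w : E} (hw : ∀ τ : Perm Y, τ y₀ = y₀ → ρ τ w = w)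
    (σ : Perm Y) (x : Y) : ρ σ (ρ (swap y₀ x) w) = ρ (swap y₀ (σ x)) w := by
  have h := hw (swap y₀ (σ x) * σ * swap y₀ x) (by simp)
  conv_rhs => rw [← h]
  rw [← Module.End.mul_apply, ← Module.End.mul_apply, ← map_mul, ← map_mul]
  congr 2
  rw [← mul_assoc, ← mul_assoc, swap_mul_self, one_mul]

/-- An irreducible representation of a symmetric group without invariants but with a nonzero vector
fixed by a point stabilizer is bounded by the standard representation. -/
lemma standard_bounds (hY : (Fintype.card Y : K) ≠ 0) {W : Submodule K E} (hW : Irred ρ W)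
    (h0 : ∀ v ∈ W, (∀ σ, ρ σ v = v) → v = 0) {y₀ : Y} {w : E} (hwW : w ∈ W) (hw0 : w ≠ 0)
    (hw : ∀ τ : Perm Y, τ y₀ = y₀ → ρ τ w = w) :
    Fintype.card Y ≤ Module.finrank K W + 1 ∧
    ∀ (c : Y → ℕ) (F : Submodule K E),
      (∀ v ∈ F, ∀ x y, c x = c y → ρ (swap x y) v = v) →
      Module.finrank K ↥(W ⊓ F) + 1 ≤ (Finset.univ.image c).card := by
  set t : Y → E := fun x => ρ (swap y₀ x) w with ht
  have hact : ∀ (σ : Perm Y) x, ρ σ (t x) = t (σ x) := fun σ x => translate_apply hw σ x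
  have htW : ∀ x, t x ∈ W := fun x => hW.1 _ _ hwW
  have ht0 : t y₀ = w := by
    simp only [ht, swap_self]
    exact hw 1 rfl
  -- The sum of the translates is invariant, so `h0` kills it.
  have hsum : ∑ x, t x = 0 := by
    refine h0 _ (W.sum_mem fun x _ => htW x) fun σ => ?_
    rw [map_sum]
    simp only [hact]
    exact Equiv.sum_comp σ t
  -- Two equal translates would force all to be equal, and their vanishing sum would be `|Y| • w`.
  have hne : ∀ x y, x ≠ y → t x ≠ t y := by
    intro x y hxy h
    have hall : ∀ z, t z = t x := by
      intro z
      by_cases hzx : z = x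
      · rw [hzx]
      by_cases hzy : z = y
      · rw [hzy, h]
      have := congrArg (ρ (swap y z)) h
      rw [hact, hact, swap_apply_left, swap_apply_of_ne_of_ne hxy (Ne.symm hzx)] at this
      exact this.symm
    rw [Finset.sum_congr rfl (fun z _ => hall z), Finset.sum_const, Finset.card_univ,
      ← Nat.cast_smul_eq_nsmul K, smul_eq_zero] at hsum
    exact hw0 (by rw [← ht0, hall y₀]; exact hsum.resolve_left hY)
  let φ : (Y → K) →ₗ[K] E := Fintype.linearCombination K t
  have hφ : ∀ g, φ g = ∑ x, g x • t x := fun g => rfl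
  have hφσ : ∀ (σ : Perm Y) g, ρ σ (φ g) = φ (g ∘ σ.symm) := by
    intro σ g
    rw [hφ, hφ, map_sum, ← Equiv.sum_comp σ (fun x => (g ∘ σ.symm) x • t x)]
    exact Finset.sum_congr rfl fun x _ => by simp [hact]
  -- The transposition changes `φ g` by `(g b - g a) • (t a - t b)`, all other terms cancelling.
  have hkey : ∀ g a b, ρ (swap a b) (φ g) = φ g → g a = g b := by
    intro g a b h
    by_cases hab : a = b
    · rw [hab]
    rw [hφσ, ← sub_eq_zero, ← map_sub, hφ, Fintype.sum_eq_add a b hab] at h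
    · simp only [Pi.sub_apply, Function.comp_apply, symm_swap, swap_apply_left,
        swap_apply_right] at h
      have h' : (g b - g a) • (t a - t b) = 0 := by
        rw [← h, smul_sub, sub_eq_add_neg, ← neg_smul, neg_sub]
      rcases smul_eq_zero.1 h' with h' | h'
      · exact (sub_eq_zero.1 h').symm
      · exact absurd (sub_eq_zero.1 h') (hne a b hab)
    · rintro x ⟨hxa, hxb⟩
      simp [swap_apply_of_ne_of_ne hxa hxb]
  have hrange : LinearMap.range φ = W := by
    have hle : LinearMap.range φ ≤ W := by
      rintro _ ⟨g, rfl⟩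
      exact W.sum_mem fun x _ => W.smul_mem _ (htW x)
    refine (hW.2.2 _ hle ?_).resolve_left ?_
    · rintro σ _ ⟨g, rfl⟩
      exact ⟨_, (hφσ σ g).symm⟩
    · intro h
      have : w ∈ LinearMap.range φ :=
        ⟨Pi.single y₀ 1, by rw [Fintype.linearCombination_apply_single, one_smul, ht0]⟩
      rw [h] at this
      exact hw0 (by simpa using this)
  have hone : φ (fun _ => 1) = 0 := by
    rw [hφ, ← hsum]
    simp
  constructor
  · have h1 := LinearMap.finrank_range_add_finrank_ker φ
    rw [hrange, Module.finrank_fintype_fun_eq_card] at h1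
    -- An element of the kernel is constant, by `hkey` applied to `φ g = 0`.
    have h2 : Module.finrank K (LinearMap.ker φ) ≤ 1 := by
      refine (Submodule.finrank_mono (?_ : _ ≤ Submodule.span K {fun _ => (1 : K)})).trans
        ((finrank_span_le_card _).trans (by simp))
      intro g hg
      have hg : φ g = 0 := hg
      refine Submodule.mem_span_singleton.2 ⟨g y₀, ?_⟩
      ext x
      simp only [Pi.smul_apply, smul_eq_mul, mul_one]
      exact hkey g y₀ x (by rw [hg, map_zero])
    omega
  · intro c F hF
    let π : Y → Finset.univ.image c := fun x => ⟨c x, Finset.mem_image_of_mem _ (Finset.mem_univ x)⟩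
    let ψ : (Finset.univ.image c → K) →ₗ[K] E := φ ∘ₗ LinearMap.funLeft K K π
    -- By `hkey`, a preimage under `φ` of a vector of `F` is a function of the colour. One dimension
    -- is then lost because `φ` kills constants.
    have hle : W ⊓ F ≤ LinearMap.range ψ := by
      rintro v ⟨hvW, hvF⟩
      rw [← hrange] at hvW
      obtain ⟨g, rfl⟩ := hvW
      have hsurj : ∀ b : Finset.univ.image c, ∃ x, π x = b := by
        rintro ⟨b, hb⟩
        obtain ⟨x, -, hx⟩ := Finset.mem_image.1 hb
        exact ⟨x, Subtype.ext hx⟩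
      choose s hs using hsurj
      refine ⟨g ∘ s, ?_⟩
      simp only [ψ, LinearMap.comp_apply]
      congr 1
      ext x
      simp only [LinearMap.funLeft_apply, Function.comp_apply]
      exact hkey g _ _ (hF _ hvF _ _ (congrArg Subtype.val (hs (π x))))
    have h1 := LinearMap.finrank_range_add_finrank_ker ψ
    rw [Module.finrank_fintype_fun_eq_card, Fintype.card_coe] at h1
    have h2 : 0 < Module.finrank K (LinearMap.ker ψ) := by
      rw [Module.finrank_pos_iff_exists_ne_zero]
      refine ⟨⟨fun _ => 1, hone⟩, fun h => ?_⟩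
      have := congrFun (congrArg Subtype.val h) (π y₀)
      exact one_ne_zero this
    have h3 := Submodule.finrank_mono hle
    omega

end Standard

/-! ### Vectors fixed by Young subgroups, given by colourings. -/

section Young

open Equiv

variable {K E X : Type*} [Field K] [AddCommGroup E] [Module K E] [FiniteDimensional K E]
  [Fintype X] [DecidableEq X]

/-- The restriction of a representation of the symmetric group of `X` to the permutations moving
only points of `Y`. -/
noncomputable def onFinset (ρ : Representation K (Perm X) E) (Y : Finset X) : Representation K (Perm Y) E :=
  MonoidHom.comp ρ Perm.ofSubtype

/-- The vectors fixed by the transpositions of points of `Y` of the same colour. -/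
def fixedBy (ρ : Representation K (Perm X) E) (Y : Finset X) (c : X → ℕ) : Submodule K E where
  carrier := {w | ∀ x ∈ Y, ∀ y ∈ Y, c x = c y → ρ (swap x y) w = w}
  add_mem' := fun ha hb x hx y hy h => by rw [map_add, ha x hx y hy h, hb x hx y hy h]
  zero_mem' := fun x _ y _ _ => map_zero _
  smul_mem' := fun r w hw x hx y hy h => by rw [map_smul, hw x hx y hy h]

/-- The vectors fixed by all permutations of `Y`. -/
abbrev invariantsOn (ρ : Representation K (Perm X) E) (Y : Finset X) : Submodule K E :=
  fixedBy ρ Y fun _ => 0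

variable {ρ : Representation K (Perm X) E} {Y : Finset X} {W : Submodule K E} {c : X → ℕ}

lemma onFinset_swap (x y : Y) : onFinset ρ Y (swap x y) = ρ (swap (x : X) (y : X)) := by
  simp only [onFinset, MonoidHom.comp_apply]
  congr 1
  exact Perm.ofSubtype_swap_eq x y

lemma stable_onFinset_iff :
    Stable (onFinset ρ Y) W ↔ ∀ x ∈ Y, ∀ y ∈ Y, ∀ w ∈ W, ρ (swap x y) w ∈ W := by
  constructor
  · intro h x hx y hy w hw
    have := h (swap ⟨x, hx⟩ ⟨y, hy⟩) w hw
    rwa [onFinset_swap] at this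
  · intro h g
    induction g using Perm.swap_induction_on with
    | one => intro w hw; rwa [map_one]
    | swap_mul f x y _ ih =>
      intro w hw
      rw [map_mul, Module.End.mul_apply, onFinset_swap]
      exact h _ x.2 _ y.2 _ (ih w hw)

lemma Stable.onFinset_mono {Y' : Finset X} (h : Stable (onFinset ρ Y) W) (hY : Y' ⊆ Y) :
    Stable (onFinset ρ Y') W :=
  stable_onFinset_iff.2 fun x hx y hy => stable_onFinset_iff.1 h x (hY hx) y (hY hy)

lemma fixedBy_mono {Y' : Finset X} (hY : Y' ⊆ Y) : fixedBy ρ Y c ≤ fixedBy ρ Y' c :=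
  fun _ hw x hx y hy h => hw x (hY hx) y (hY hy) h

lemma fixedBy_eq_invariantsOn (h : (Y.image c).card ≤ 1) : fixedBy ρ Y c = invariantsOn ρ Y := by
  have : ∀ x ∈ Y, ∀ y ∈ Y, c x = c y := fun x hx y hy =>
    Finset.card_le_one.1 h _ (Finset.mem_image_of_mem _ hx) _ (Finset.mem_image_of_mem _ hy)
  ext w
  exact ⟨fun hw x hx y hy _ => hw x hx y hy (this x hx y hy), fun hw x hx y hy _ => hw x hx y hy rfl⟩

/-- Only transpositions are tested in `fixedBy`; they generate the permutations supported on `Y`. -/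
lemma apply_of_mem_invariantsOn {w : E} (hw : w ∈ invariantsOn ρ Y) {σ : Perm X}
    (hσ : ∀ x ∉ Y, σ x = x) : ρ σ w = w := by
  have key : ∀ g : Perm Y, onFinset ρ Y g w = w := by
    intro g
    induction g using Perm.swap_induction_on with
    | one => rw [map_one]; rfl
    | swap_mul f x y _ ih =>
      rw [map_mul, Module.End.mul_apply, ih, onFinset_swap]
      exact hw _ x.2 _ y.2 rfl
  have h2 : ∀ x, σ x ≠ x → x ∈ Y := fun x hx => by_contra fun h => hx (hσ x h)
  have h1 : ∀ x, σ x ∈ Y ↔ x ∈ Y := by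
    intro x
    by_cases hx : σ x = x
    · rw [hx]
    · exact iff_of_true (h2 _ fun h => hx (σ.injective h)) (h2 x hx)
  have := key (σ.subtypePerm h1)
  rwa [onFinset, MonoidHom.comp_apply, Perm.ofSubtype_subtypePerm h1 h2] at this

/-- For distinct points, `swap a d` is the conjugate of `swap b d` by `swap a b`. This is what
allows blocks to be merged. -/
lemma swap_fixed_trans {w : E} {a b d : X} (h1 : ρ (swap a b) w = w) (h2 : ρ (swap b d) w = w) :
    ρ (swap a d) w = w := by
  by_cases hab : a = b
  · rwa [hab]
  by_cases hbd : b = d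
  · rwa [← hbd]
  by_cases had : a = d
  · rw [had, swap_self]; change ρ 1 w = w; rw [map_one]; rfl
  have : swap a d = swap a b * swap b d * swap a b := by
    have := swap_apply_apply (swap a b) b d
    rw [swap_apply_right, swap_apply_of_ne_of_ne (Ne.symm had) (Ne.symm hbd), swap_inv] at this
    exact this
  rw [this, map_mul, map_mul, Module.End.mul_apply, Module.End.mul_apply, h1, h2, h1]

/-- The vector `ρ τ a - a = b - ρ τ b` lies in `A ⊓ B = ⊥` for each transposition `τ` concerned.
This provides the hypothesis `hF` of `finrank_inf_le_of_irred`. -/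
lemma fixedBy_additive {A B : Submodule K E} (hA : Stable (onFinset ρ Y) A)
    (hB : Stable (onFinset ρ Y) B) (hAB : A ⊓ B = ⊥) {a b : E} (ha : a ∈ A) (hb : b ∈ B)
    (h : a + b ∈ fixedBy ρ Y c) : a ∈ fixedBy ρ Y c ∧ b ∈ fixedBy ρ Y c := by
  have key : ∀ x ∈ Y, ∀ y ∈ Y, c x = c y → ρ (swap x y) a = a ∧ ρ (swap x y) b = b := by
    intro x hx y hy hc
    have h' := h x hx y hy hc
    rw [map_add] at h'
    have e : ρ (swap x y) a - a = b - ρ (swap x y) b := by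
      rw [sub_eq_sub_iff_add_eq_add, h', add_comm]
    have hmem : ρ (swap x y) a - a ∈ A ⊓ B :=
      ⟨A.sub_mem (stable_onFinset_iff.1 hA x hx y hy a ha) ha,
        e ▸ B.sub_mem hb (stable_onFinset_iff.1 hB x hx y hy b hb)⟩
    rw [hAB, Submodule.mem_bot] at hmem
    exact ⟨sub_eq_zero.1 hmem, (sub_eq_zero.1 (e ▸ hmem)).symm⟩
  exact ⟨fun x hx y hy hc => (key x hx y hy hc).1, fun x hx y hy hc => (key x hx y hy hc).2⟩

lemma inf_eq_bot_mono {A B A' B' : Submodule K E} (h : A ⊓ B = ⊥) (hA : A' ≤ A) (hB : B' ≤ B) :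
    A' ⊓ B' = ⊥ :=
  eq_bot_iff.2 ((inf_le_inf hA hB).trans h.le)

lemma natCast_factorial_ne_zero (hX : ((Fintype.card X).factorial : K) ≠ 0) (Y : Finset X) :
    (Y.card.factorial : K) ≠ 0 := by
  obtain ⟨k, hk⟩ := Nat.factorial_dvd_factorial Y.card_le_univ
  rw [hk, Nat.cast_mul] at hX
  exact left_ne_zero_of_mul hX

lemma card_perm_ne_zero (hX : ((Fintype.card X).factorial : K) ≠ 0) (Y : Finset X) :
    (Fintype.card (Perm Y) : K) ≠ 0 := by
  rw [Fintype.card_perm, Fintype.card_coe]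
  exact natCast_factorial_ne_zero hX Y

lemma standard_bounds_onFinset (hX : ((Fintype.card X).factorial : K) ≠ 0)
    (hW : Irred (onFinset ρ Y) W) (h0 : W ⊓ invariantsOn ρ Y = ⊥) {y : X} (hy : y ∈ Y)
    (h1 : W ⊓ invariantsOn ρ (Y.erase y) ≠ ⊥) :
    Y.card ≤ Module.finrank K W + 1 ∧
      ∀ c, Module.finrank K ↥(W ⊓ fixedBy ρ Y c) + 1 ≤ (Y.image c).card := by
  obtain ⟨w, ⟨hwW, hw⟩, hw0⟩ := Submodule.exists_mem_ne_zero_of_ne_bot h1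
  have hcard : (Fintype.card Y : K) ≠ 0 := by
    have := natCast_factorial_ne_zero hX Y
    rw [← Nat.mul_factorial_pred (Finset.card_ne_zero_of_mem hy), Nat.cast_mul] at this
    rw [Fintype.card_coe]
    exact left_ne_zero_of_mul this
  obtain ⟨h2, h3⟩ := standard_bounds hcard hW (y₀ := ⟨y, hy⟩) (w := w)
    (fun v hv hσ => by
      have : v ∈ W ⊓ invariantsOn ρ Y := ⟨hv, fun a ha b hb _ => by
        have := hσ (swap ⟨a, ha⟩ ⟨b, hb⟩)
        rwa [onFinset_swap] at this⟩
      rw [h0] at this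
      simpa using this) hwW hw0
    (fun τ hτ => apply_of_mem_invariantsOn hw (by
      intro x hx
      rw [Finset.mem_erase, not_and_or, not_not] at hx
      rcases hx with rfl | hx
      · rw [Perm.ofSubtype_apply_of_mem τ hy, hτ]
      · exact Perm.ofSubtype_apply_of_not_mem τ hx))
  rw [Fintype.card_coe] at h2
  refine ⟨h2, fun c => ?_⟩
  have h4 := h3 (fun x => c x) (fixedBy ρ Y c) (fun v hv x y hxy => by
    rw [onFinset_swap]; exact hv x x.2 y y.2 hxy)
  refine h4.trans (Finset.card_le_card ?_)
  intro b hb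
  obtain ⟨x, -, rfl⟩ := Finset.mem_image.1 hb
  exact Finset.mem_image_of_mem _ x.2

end Young

end SymIdeal

namespace SymIdeal

/-! ### Upper bounds for the proportion of vectors fixed by a Young subgroup. -/

section Inequalities

open Equiv

variable {K E X : Type*} [Field K] [AddCommGroup E] [Module K E] [FiniteDimensional K E]
  [Fintype X] [DecidableEq X] {ρ : Representation K (Perm X) E}

lemma image_erase_of_exists {Y : Finset X} {c : X → ℕ} {x x' : X} (hx' : x' ∈ Y) (hne : x' ≠ x)
    (hc : c x' = c x) : (Y.erase x).image c = Y.image c := by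
  refine subset_antisymm (Finset.image_subset_image (Finset.erase_subset _ _)) fun b hb => ?_
  obtain ⟨z, hz, rfl⟩ := Finset.mem_image.1 hb
  by_cases h : z = x
  · exact Finset.mem_image.2 ⟨x', Finset.mem_erase.2 ⟨hne, hx'⟩, by rw [h, hc]⟩
  · exact Finset.mem_image_of_mem _ (Finset.mem_erase.2 ⟨h, hz⟩)

lemma image_erase_of_forall {Y : Finset X} {c : X → ℕ} {x : X} (h : ∀ z ∈ Y, c z = c x → z = x) :
    (Y.erase x).image c = (Y.image c).erase (c x) := by
  ext b
  simp only [Finset.mem_image, Finset.mem_erase]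
  constructor
  · rintro ⟨z, ⟨hzx, hz⟩, rfl⟩
    exact ⟨fun hc => hzx (h z hz hc), z, hz, rfl⟩
  · rintro ⟨hb, z, hz, rfl⟩
    exact ⟨z, ⟨fun hzx => hb (by rw [hzx]), hz⟩, rfl⟩

/-- The condition `m q ≤ N` means `(q - 1) N ≤ q (N - m)`: for a block of at most average size, the
bound with `N - m` implies the one with `N`. -/
lemma mul_le_mul_of_small_part {N m q u f : ℕ} (hq : 2 ≤ q) (hm : m * q ≤ N)
    (h : (N - m) * u ≤ (q - 1) * f) : N * u ≤ q * f := by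
  obtain ⟨q, rfl⟩ : ∃ q', q = q' + 2 := ⟨q - 2, by omega⟩
  obtain ⟨e, rfl⟩ : ∃ e, N = m + e := Nat.exists_eq_add_of_le (by nlinarith)
  rw [Nat.add_sub_cancel_left, show q + 2 - 1 = q + 1 by omega] at h
  have h4 : (q + 1) * ((m + e) * u) ≤ (q + 1) * ((q + 2) * f) := by
    calc (q + 1) * ((m + e) * u) = ((q + 1) * (m + e)) * u := by ring
      _ ≤ ((q + 2) * e) * u := Nat.mul_le_mul_right _ (by nlinarith)
      _ = (q + 2) * (e * u) := by ring
      _ ≤ (q + 2) * ((q + 1) * f) := Nat.mul_le_mul_left _ h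
      _ = _ := by ring
  exact Nat.le_of_mul_le_mul_left h4 (by omega)

/-- Dimension bound for the vectors fixed by a Young subgroup in a representation without
invariants, in terms of the size of a block that is not larger than average. -/
lemma finrank_fixedBy_le_of_small_block (hX : ((Fintype.card X).factorial : K) ≠ 0) (n : ℕ) :
    ∀ (Y : Finset X), Y.card = n → ∀ (W : Submodule K E), Stable (onFinset ρ Y) W →
      W ⊓ invariantsOn ρ Y = ⊥ → ∀ (c : X → ℕ) (b : ℕ), b ∈ Y.image c →
      (Y.filter fun x => c x = b).card * (Y.image c).card ≤ n →
      (n - (Y.filter fun x => c x = b).card) * Module.finrank K ↥(W ⊓ fixedBy ρ Y c) ≤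
        ((Y.image c).card - 1) * Module.finrank K W := by
  induction n with
  | zero => intros; simp
  | succ N ih =>
    intro Y hY W hW hW0 c b hb hm
    refine finrank_inf_le_of_irred (card_perm_ne_zero hX Y)
      (fun A B hA hB hAB a ha b hb h => fixedBy_additive hA hB hAB ha hb h) _ _ hW ?_
    intro U hUW hU
    have hU0 : U ⊓ invariantsOn ρ Y = ⊥ := inf_eq_bot_mono hW0 hUW le_rfl
    obtain ⟨y, hy, rfl⟩ := Finset.mem_image.1 hb
    have hyc : y ∈ Y.filter fun x => c x = c y := Finset.mem_filter.2 ⟨hy, rfl⟩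
    have hmpos : 0 < (Y.filter fun x => c x = c y).card := Finset.card_pos.2 ⟨y, hyc⟩
    have hkpos : 0 < (Y.image c).card := Finset.card_pos.2 ⟨_, hb⟩
    set m := (Y.filter fun x => c x = c y).card with hmdef
    -- Either `U` restricted to `Y.erase y` has no invariants and induction applies, or `U` is a
    -- standard representation and is bounded directly.
    by_cases h1 : U ⊓ invariantsOn ρ (Y.erase y) = ⊥
    · have hYe : (Y.erase y).card = N := by rw [Finset.card_erase_of_mem hy, hY]; rfl
      have hUs : Stable (onFinset ρ (Y.erase y)) U := hU.1.onFinset_mono (Finset.erase_subset _ _)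
      have hmono : Module.finrank K ↥(U ⊓ fixedBy ρ Y c) ≤
          Module.finrank K ↥(U ⊓ fixedBy ρ (Y.erase y) c) :=
        Submodule.finrank_mono (inf_le_inf_left _ (fixedBy_mono (Finset.erase_subset _ _)))
      have hfil : ((Y.erase y).filter fun x => c x = c y) = (Y.filter fun x => c x = c y).erase y := by
        ext z; simp only [Finset.mem_filter, Finset.mem_erase]; tauto
      have hfilc : ((Y.erase y).filter fun x => c x = c y).card = m - 1 := by
        rw [hfil, Finset.card_erase_of_mem hyc]
      by_cases hm1 : 1 < m
      · obtain ⟨x', hx', hne⟩ := Finset.exists_mem_ne hm1 y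
        obtain ⟨hx'Y, hx'c⟩ := Finset.mem_filter.1 hx'
        have him := image_erase_of_exists hx'Y hne hx'c
        have := ih (Y.erase y) hYe U hUs h1 c (c y) (him ▸ hb) (by
          rw [hfilc, him]
          have : (m - 1) * (Y.image c).card + (Y.image c).card = m * (Y.image c).card := by
            rw [← Nat.succ_mul]; congr 1; omega
          omega)
        rw [hfilc, him] at this
        have e : N + 1 - m = N - (m - 1) := by omega
        rw [e]
        exact (Nat.mul_le_mul_left _ hmono).trans this
      · have hm1 : m = 1 := by omega
        have hall : ∀ z ∈ Y, c z = c y → z = y := fun z hz hc =>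
          Finset.card_le_one.1 (hmdef ▸ hm1.le) z (Finset.mem_filter.2 ⟨hz, hc⟩) y hyc
        have him := image_erase_of_forall hall
        have himc : ((Y.erase y).image c).card = (Y.image c).card - 1 := by
          rw [him, Finset.card_erase_of_mem hb]
        rw [hm1, Nat.add_sub_cancel]
        set q := (Y.image c).card - 1 with hq
        by_cases hq2 : q ≤ 1
        · rw [fixedBy_eq_invariantsOn (himc.le.trans hq2), h1, finrank_bot] at hmono
          rw [Nat.le_zero.1 hmono]
          simp
        -- The block of `y` has disappeared; among the remaining `q` blocks on `N` points, one is
        -- not larger than average.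
        · obtain ⟨b', hb', hb'c⟩ : ∃ b' ∈ (Y.erase y).image c,
              ((Y.erase y).filter fun x => c x = b').card * q ≤ N := by
            by_contra! hcon
            have hs := Finset.card_eq_sum_card_image c (Y.erase y)
            have h2 : ∑ b ∈ (Y.erase y).image c, (N + 1) ≤
                ∑ b ∈ (Y.erase y).image c, ((Y.erase y).filter fun x => c x = b).card * q :=
              Finset.sum_le_sum fun b hb => hcon b hb
            rw [← Finset.sum_mul, ← hs, hYe, Finset.sum_const, himc, smul_eq_mul] at h2
            nlinarith
          have := ih (Y.erase y) hYe U hUs h1 c b' hb' (by rw [himc]; exact hb'c)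
          rw [himc] at this
          set m' := ((Y.erase y).filter fun x => c x = b').card
          have h3 := (Nat.mul_le_mul_left (N - m') hmono).trans this
          exact mul_le_mul_of_small_part (by omega) hb'c h3
    · obtain ⟨h2, h3⟩ := standard_bounds_onFinset hX hU hU0 hy h1
      have h3 := h3 c
      rw [mul_comm]
      exact Nat.mul_le_mul (by omega) (by omega)

/-- The case of a block with a single point. -/
lemma finrank_fixedBy_le_of_singleton (hX : ((Fintype.card X).factorial : K) ≠ 0)
    {Y : Finset X} {W : Submodule K E} (hW : Stable (onFinset ρ Y) W)
    (h0 : W ⊓ invariantsOn ρ Y = ⊥) {c : X → ℕ} {x : X} (hx : x ∈ Y)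
    (h : ∀ z ∈ Y, c z = c x → z = x) :
    (Y.card - 1) * Module.finrank K ↥(W ⊓ fixedBy ρ Y c) ≤
      ((Y.image c).card - 1) * Module.finrank K W := by
  have h1 : (Y.filter fun z => c z = c x).card = 1 := by
    rw [Finset.card_eq_one]
    exact ⟨x, by ext z; simp only [Finset.mem_filter, Finset.mem_singleton]
                 exact ⟨fun hz => h z hz.1 hz.2, fun hz => by subst hz; exact ⟨hx, rfl⟩⟩⟩
  have := finrank_fixedBy_le_of_small_block hX Y.card Y rfl W hW h0 c (c x)
    (Finset.mem_image_of_mem _ hx) (by rw [h1, one_mul]; exact Finset.card_image_le)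
  rwa [h1] at this

/-- The operator `ρ (swap x y)` carries the vectors fixed by a Young subgroup to those fixed by its
conjugate. -/
lemma finrank_inf_fixedBy_comp_swap {Y : Finset X} {W : Submodule K E}
    (hW : Stable (onFinset ρ Y) W) (c : X → ℕ) {x y : X} (hx : x ∈ Y) (hy : y ∈ Y) :
    Module.finrank K ↥(W ⊓ fixedBy ρ Y c) ≤
      Module.finrank K ↥(W ⊓ fixedBy ρ Y (c ∘ swap x y)) := by
  have hinv : ∀ v, ρ (swap x y) (ρ (swap x y) v) = v := by
    intro v
    rw [← Module.End.mul_apply, ← map_mul, swap_mul_self, map_one, Module.End.one_apply]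
  have hinj : Function.Injective (ρ (swap x y)) := fun v w h => by
    rw [← hinv v, h, hinv]
  have hmem : ∀ w ∈ W ⊓ fixedBy ρ Y c, ρ (swap x y) w ∈ W ⊓ fixedBy ρ Y (c ∘ swap x y) := by
    rintro w ⟨hwW, hw⟩
    refine ⟨stable_onFinset_iff.1 hW x hx y hy w hwW, fun a ha b hb hab => ?_⟩
    have hY : ∀ a ∈ Y, swap x y a ∈ Y := by
      intro a ha
      rw [swap_apply_def]
      split_ifs <;> assumption
    have := hw _ (hY a ha) _ (hY b hb) hab
    have e : swap a b = swap x y * swap (swap x y a) (swap x y b) * swap x y := by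
      rw [← swap_inv x y, swap_inv, swap_apply_apply]
      simp [mul_assoc]
    rw [e, map_mul, map_mul, Module.End.mul_apply, Module.End.mul_apply, hinv, this]
  exact LinearMap.finrank_le_finrank_of_injective (f := (ρ (swap x y)).restrict hmem)
    fun v w h => Subtype.ext (hinj (congrArg Subtype.val h))

/-- Dimension bound for the vectors fixed by a Young subgroup in a representation in which the
point stabilizers have no nonzero fixed vectors. -/
lemma finrank_fixedBy_le_of_point_stabilizers (hX : ((Fintype.card X).factorial : K) ≠ 0)
    {Y : Finset X} {W : Submodule K E} (hW : Stable (onFinset ρ Y) W)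
    (h0 : ∀ y ∈ Y, W ⊓ invariantsOn ρ (Y.erase y) = ⊥) (hYne : Y.Nonempty) (k : ℕ) :
    ∀ c : X → ℕ, (Y.image c).card = k + 1 →
      (Y.card - 2) * Module.finrank K ↥(W ⊓ fixedBy ρ Y c) ≤ k * Module.finrank K W := by
  obtain ⟨y₀, hy₀⟩ := hYne
  have hY0 : W ⊓ invariantsOn ρ Y = ⊥ :=
    inf_eq_bot_mono (h0 y₀ hy₀) le_rfl (fixedBy_mono (Finset.erase_subset _ _))
  induction k with
  | zero =>
    intro c hc
    rw [fixedBy_eq_invariantsOn hc.le, hY0]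
    simp
  | succ k ih =>
    intro c hc
    by_cases hs : ∃ x ∈ Y, ∀ z ∈ Y, c z = c x → z = x
    · obtain ⟨x, hx, hxs⟩ := hs
      have := finrank_fixedBy_le_of_singleton hX hW hY0 hx hxs
      rw [hc, Nat.add_sub_cancel] at this
      exact (Nat.mul_le_mul_right _ (by omega)).trans this
    -- No block is a singleton. Let `A`, `B` be the fixed spaces of the Young subgroup and of its
    -- conjugate by `swap x y`, with `x`, `y` in different blocks. Then `2 dim A ≤ dim (A ⊔ B) + dim
    -- (A ⊓ B)`, where `A ⊓ B` is fixed by the join of the two subgroups and `A ⊔ B` by their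
    -- intersection.
    push Not at hs
    obtain ⟨_, hbx, _, hby, hbne⟩ := Finset.one_lt_card.1 (show 1 < (Y.image c).card by omega)
    obtain ⟨x, hx, rfl⟩ := Finset.mem_image.1 hbx
    obtain ⟨y, hy, rfl⟩ := Finset.mem_image.1 hby
    obtain ⟨x', hx', hcx', hx'x⟩ := hs x hx
    obtain ⟨y', hy', hcy', hy'y⟩ := hs y hy
    have hxy : x ≠ y := fun h => hbne (by rw [h])
    have hx'y : x' ≠ y := fun h => hbne (by rw [← h, hcx'])
    have hy'x : y' ≠ x := fun h => hbne (by rw [← h, hcy'])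
    -- the common refinement, restricted to the complement of `x`
    obtain ⟨b, hb⟩ := Infinite.exists_notMem_finset (Y.image c)
    have hcb : ∀ z ∈ Y, c z ≠ b := fun z hz h => hb (h ▸ Finset.mem_image_of_mem _ hz)
    have hyx : y ∈ Y.erase x := Finset.mem_erase.2 ⟨hxy.symm, hy⟩
    have hmeet := finrank_fixedBy_le_of_singleton hX
      (hW.onFinset_mono (Finset.erase_subset x Y)) (h0 x hx) (c := Function.update c y b) hyx
      (by
        intro z hz hzc
        by_contra hzy
        rw [Function.update_self, Function.update_of_ne hzy] at hzc
        exact hcb z (Finset.mem_of_mem_erase hz) hzc)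
    have himg : ((Y.erase x).image (Function.update c y b)).card ≤ k + 3 := by
      have : (Y.erase x).image (Function.update c y b) ⊆ insert b (Y.image c) := by
        intro e he
        obtain ⟨z, hz, rfl⟩ := Finset.mem_image.1 he
        by_cases hzy : z = y
        · rw [hzy, Function.update_self]; exact Finset.mem_insert_self _ _
        · rw [Function.update_of_ne hzy]
          exact Finset.mem_insert_of_mem (Finset.mem_image_of_mem _ (Finset.mem_of_mem_erase hz))
      exact (Finset.card_le_card this).trans ((Finset.card_insert_le _ _).trans (by omega))
    -- the join, merging the blocks of `x` and `y`
    have hjoin := ih (fun z => if c z = c y then c x else c z) (by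
      have : Y.image (fun z => if c z = c y then c x else c z) = (Y.image c).erase (c y) := by
        ext e
        simp only [Finset.mem_image, Finset.mem_erase]
        constructor
        · rintro ⟨z, hz, rfl⟩
          split_ifs with h
          · exact ⟨hbne, x, hx, rfl⟩
          · exact ⟨h, z, hz, rfl⟩
        · rintro ⟨he, z, hz, rfl⟩
          exact ⟨z, hz, by rw [if_neg he]⟩
      rw [this, Finset.card_erase_of_mem hby, hc]
      rfl)
    set A := W ⊓ fixedBy ρ Y c with hA
    set B := W ⊓ fixedBy ρ Y (c ∘ swap x y) with hB
    have hAB : Module.finrank K A ≤ Module.finrank K B := finrank_inf_fixedBy_comp_swap hW c hx hy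
    have hinf : A ⊓ B ≤ W ⊓ fixedBy ρ Y (fun z => if c z = c y then c x else c z) := by
      rintro w ⟨⟨hwW, hw⟩, -, hw'⟩
      -- A second point `x'` of the block of `x` links `y` to `x`: `y` and `x'` share a block of the
      -- conjugate colouring, `x'` and `x` one of the original.
      have hyx : ρ (swap y x) w = w := by
        refine swap_fixed_trans (b := x') (hw' y hy x' hx' ?_) (hw x' hx' x hx hcx')
        rw [Function.comp_apply, Function.comp_apply, swap_apply_right,
          swap_apply_of_ne_of_ne hx'x hx'y, hcx']
      have hxy' : ρ (swap x y) w = w := by rwa [swap_comm]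
      refine ⟨hwW, fun p hp q hq hpq => ?_⟩
      by_cases h1 : c p = c y <;> by_cases h2 : c q = c y
      · exact hw p hp q hq (h1.trans h2.symm)
      · simp only [h1, h2, if_true, if_false] at hpq
        exact swap_fixed_trans (hw p hp y hy h1) (swap_fixed_trans hyx (hw x hx q hq hpq))
      · simp only [h1, h2, if_true, if_false] at hpq
        exact swap_fixed_trans (hw p hp x hx hpq) (swap_fixed_trans hxy' (hw y hy q hq h2.symm))
      · simp only [h1, h2, if_false] at hpq
        exact hw p hp q hq hpq
    have hsup : A ⊔ B ≤ W ⊓ fixedBy ρ (Y.erase x) (Function.update c y b) := by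
      refine sup_le (inf_le_inf_left _ ?_) (inf_le_inf_left _ ?_)
      all_goals
        intro w hw p hp q hq hpq
        obtain ⟨hpx, hpY⟩ := Finset.mem_erase.1 hp
        obtain ⟨hqx, hqY⟩ := Finset.mem_erase.1 hq
        by_cases h1 : p = y <;> by_cases h2 : q = y
        · rw [h1, h2, swap_self]
          change ρ 1 w = w
          rw [map_one]; rfl
        · rw [h1, Function.update_self, Function.update_of_ne h2] at hpq
          exact absurd hpq.symm (hcb q hqY)
        · rw [h2, Function.update_self, Function.update_of_ne h1] at hpq
          exact absurd hpq (hcb p hpY)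
        · rw [Function.update_of_ne h1, Function.update_of_ne h2] at hpq
          refine hw p hpY q hqY ?_
          simp only [Function.comp_apply, swap_apply_of_ne_of_ne hpx h1,
            swap_apply_of_ne_of_ne hqx h2, hpq]
    have h5 := Submodule.finrank_sup_add_finrank_inf_eq A B
    have h6 := Submodule.finrank_mono hinf
    have h7 := Submodule.finrank_mono hsup
    rw [Finset.card_erase_of_mem hx, Nat.sub_sub] at hmeet
    have h8 : (Y.card - 2) * Module.finrank K ↥(A ⊔ B) ≤ (k + 2) * Module.finrank K W :=
      (Nat.mul_le_mul_left _ h7).trans (hmeet.trans (Nat.mul_le_mul_right _ (by omega)))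
    have h9 : (Y.card - 2) * Module.finrank K ↥(A ⊓ B) ≤ k * Module.finrank K W :=
      (Nat.mul_le_mul_left _ h6).trans hjoin
    have h10 : (Y.card - 2) * (2 * Module.finrank K A) ≤
        (Y.card - 2) * (Module.finrank K ↥(A ⊔ B) + Module.finrank K ↥(A ⊓ B)) :=
      Nat.mul_le_mul_left _ (by omega)
    -- The two bounds add up to `(k + 2) + k = 2 (k + 1)`.
    nlinarith

/-- The improvement of the previous bound for a Young subgroup that fixes a point. -/
lemma finrank_fixedBy_le_of_singleton_of_point_stabilizers
    (hX : ((Fintype.card X).factorial : K) ≠ 0)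
    {Y : Finset X} {W : Submodule K E} (hW : Stable (onFinset ρ Y) W)
    (h0 : ∀ y ∈ Y, W ⊓ invariantsOn ρ (Y.erase y) = ⊥) {c : X → ℕ} {x : X} (hx : x ∈ Y)
    (h : ∀ z ∈ Y, c z = c x → z = x) :
    (Y.card - 3) * Module.finrank K ↥(W ⊓ fixedBy ρ Y c) ≤
      ((Y.image c).card - 2) * Module.finrank K W := by
  by_cases hne : (Y.erase x).Nonempty
  swap
  · have : (Y.erase x).card = 0 := by rw [Finset.not_nonempty_iff_eq_empty.1 hne]; rfl
    rw [Finset.card_erase_of_mem hx] at this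
    rw [show Y.card - 3 = 0 by omega]
    simp
  have himc : ((Y.erase x).image c).card = (Y.image c).card - 1 := by
    rw [image_erase_of_forall h, Finset.card_erase_of_mem (Finset.mem_image_of_mem _ hx)]
  have hpos : 0 < ((Y.erase x).image c).card := Finset.card_pos.2 (hne.image _)
  have hcard := Finset.card_erase_of_mem hx
  refine (Nat.mul_le_mul_left _ (Submodule.finrank_mono (inf_le_inf_left _
    (fixedBy_mono (Finset.erase_subset x Y))))).trans ?_
  refine finrank_inf_le_of_irred (card_perm_ne_zero hX (Y.erase x))
    (fun A B hA hB hAB a ha b hb h => fixedBy_additive hA hB hAB ha hb h) _ _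
    (hW.onFinset_mono (Finset.erase_subset x Y)) ?_
  intro U hUW hU
  -- After deleting the fixed point `x` there is one point and one colour less; a component `U`
  -- obeys the preceding bound or is standard.
  by_cases h1 : ∀ y ∈ Y.erase x, U ⊓ invariantsOn ρ ((Y.erase x).erase y) = ⊥
  · have := finrank_fixedBy_le_of_point_stabilizers hX hU.1 h1 hne (((Y.erase x).image c).card - 1)
      c (by omega)
    rw [hcard, himc] at this
    convert this using 2 <;> omega
  · push Not at h1
    obtain ⟨y, hy, hne⟩ := h1
    obtain ⟨h2, h3⟩ := standard_bounds_onFinset hX hU (inf_eq_bot_mono (h0 x hx) hUW le_rfl) hy hne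
    have h3 := h3 c
    rw [mul_comm]
    exact Nat.mul_le_mul (by omega) (by omega)

end Inequalities

end SymIdeal

namespace SymIdeal

/-! ### Generating a semisimple representation by `r` vectors. -/

section Generators

variable {K G E : Type*} [Field K] [Group G] [AddCommGroup E] [Module K E] [FiniteDimensional K E]
  {ρ : Representation K G E}

/-- The equivariant endomorphisms with values in a subspace. -/
def equivariantInto (ρ : Representation K G E) (W : Submodule K E) :
    Submodule K (E →ₗ[K] E) where
  carrier := {θ | Equivariant ρ θ ∧ ∀ w, θ w ∈ W}
  add_mem' := fun ha hb => ⟨fun g w => by simp [ha.1 g w, hb.1 g w],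
    fun w => W.add_mem (ha.2 w) (hb.2 w)⟩
  zero_mem' := ⟨fun g w => by simp, fun w => W.zero_mem⟩
  smul_mem' := fun c θ h => ⟨fun g w => by simp [h.1 g w], fun w => W.smul_mem _ (h.2 w)⟩

/-- A representation of a finite group is generated by `r` vectors if its multiplicities are at
most `r` times those of the regular representation. -/
lemma exists_generators [Fintype G] (hG : (Fintype.card G : K) ≠ 0) (r : ℕ) {N : Submodule K E}
    (hN : Stable ρ N)
    (h : ∀ W ≤ N, Irred ρ W →
      Module.finrank K (equivariantInto ρ W) ≤ r * Module.finrank K W) :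
    ∃ v : Fin r → E, (∀ i, v i ∈ N) ∧ ∀ J, Stable ρ J → (∀ i, v i ∈ J) → N ≤ J := by
  induction hf : Module.finrank K N using Nat.strong_induction_on generalizing N with
  | _ m ih =>
    subst hf
    by_cases h0 : N = ⊥
    · exact ⟨fun _ => 0, fun i => N.zero_mem, fun J _ _ => h0 ▸ bot_le⟩
    obtain ⟨W, hWN, hW⟩ := exists_irred_le hN h0
    obtain ⟨N₁, hN₁, hN₁s, hWN₁, hWN₁'⟩ := exists_stable_compl hG hW.1 hN hWN
    have hfin := finrank_sup_of_disjoint hWN₁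
    rw [hWN₁'] at hfin
    have hWpos : 0 < Module.finrank K W := by
      rw [Nat.pos_iff_ne_zero]
      exact fun h' => hW.2.1 (Submodule.finrank_eq_zero.1 h')
    obtain ⟨v₁, hv₁, hgen⟩ := ih _ (by omega) hN₁s (fun V hV => h V (hV.trans hN₁)) rfl
    obtain ⟨π, hπ, hπW, hπN, hπr⟩ := exists_equivariant_projection hG hW.1 hN₁s hWN₁
    -- equivariant maps vanishing on `W`
    let H₁ : Submodule K (E →ₗ[K] E) :=
      equivariantInto ρ W ⊓ LinearMap.ker (LinearMap.lcomp K E W.subtype)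
    have hH₁ : ∀ θ : E →ₗ[K] E, θ ∈ equivariantInto ρ W → (∀ w ∈ W, θ w = 0) → θ ∈ H₁ := by
      intro θ hθ hθW
      refine ⟨hθ, ?_⟩
      rw [SetLike.mem_coe, LinearMap.mem_ker]
      ext w
      exact hθW _ w.2
    -- The projection `π` does not vanish on `W`. This strict inequality is what keeps `ev` from
    -- being surjective.
    have hlt : Module.finrank K H₁ < Module.finrank K (equivariantInto ρ W) := by
      refine Submodule.finrank_lt_finrank_of_lt (lt_of_le_of_ne inf_le_left fun heq => ?_)
      have hmem : π ∈ H₁ := heq ▸ (⟨hπ, hπr⟩ : π ∈ equivariantInto ρ W)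
      obtain ⟨w, hw, hw0⟩ := Submodule.exists_mem_ne_zero_of_ne_bot hW.2.1
      have h2 := LinearMap.congr_fun (LinearMap.mem_ker.1 hmem.2) ⟨w, hw⟩
      have h3 : π w = 0 := h2
      rw [hπW w hw] at h3
      exact hw0 h3
    let ev : H₁ →ₗ[K] (Fin r → W) := LinearMap.pi fun i =>
      LinearMap.codRestrict W ((LinearMap.applyₗ (v₁ i)).comp H₁.subtype) fun θ => θ.2.1.2 _
    have hev : ¬ Function.Surjective ev := by
      intro hs
      have h1 := LinearMap.finrank_le_finrank_of_surjective hs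
      rw [Module.finrank_pi_fintype, Finset.sum_const, Finset.card_univ, Fintype.card_fin,
        smul_eq_mul] at h1
      have := h W hWN hW
      omega
    simp only [Function.Surjective, not_forall, not_exists] at hev
    obtain ⟨w, hw⟩ := hev
    refine ⟨fun i => v₁ i + w i, fun i => N.add_mem (hN₁ (hv₁ i)) (hWN (w i).2), ?_⟩
    intro J hJ hJv
    rcases hW.2.2 (J ⊓ W) inf_le_right (hJ.inf hW.1) with hbot | htop
    -- If `J` missed `W`, a projection `p` onto `W` killing `J` would give `w i = -p (v₁ i)`. On
    -- `N₁` the map `-p` agrees with `p ∘ π - p`, which lies in `H₁`, contrary to the choice of `w`.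
    · exfalso
      obtain ⟨p, hp, hpW, hpJ, hpr⟩ := exists_equivariant_projection hG hW.1 hJ (by rwa [inf_comm])
      have hθ : p ∘ₗ π - p ∈ H₁ := by
        refine hH₁ _ ⟨fun g x => ?_, fun x => W.sub_mem (hpr _) (hpr _)⟩ fun x hx => ?_
        · simp only [LinearMap.sub_apply, LinearMap.comp_apply, map_sub]
          rw [hπ, hp, hp]
        · simp only [LinearMap.sub_apply, LinearMap.comp_apply]
          rw [hπW x hx, sub_self]
      refine hw ⟨_, hθ⟩ (funext fun i => Subtype.ext ?_)
      change p (π (v₁ i)) - p (v₁ i) = w i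
      have h1 := hpJ _ (hJv i)
      rw [map_add, hpW _ (w i).2] at h1
      rw [hπN _ (hv₁ i), map_zero, zero_sub, neg_eq_iff_add_eq_zero, h1]
    · have hWJ : W ≤ J := by rw [← htop]; exact inf_le_left
      have hNJ : N₁ ≤ J := hgen J hJ fun i => by
        have := J.sub_mem (hJv i) (hWJ (w i).2)
        rwa [add_sub_cancel_right] at this
      rw [← hWN₁']
      exact sup_le hWJ hNJ

end Generators

end SymIdeal

namespace SymIdeal

/-! ### Counting partitions. -/

section Partitions

/-- The partitions of `d`, as multisets of positive integers. -/
def partitionSet (d : ℕ) : Finset (Multiset ℕ) :=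
  (Finset.univ : Finset (Nat.Partition d)).image Nat.Partition.parts

lemma mem_partitionSet {d : ℕ} {m : Multiset ℕ} :
    m ∈ partitionSet d ↔ (∀ x ∈ m, 0 < x) ∧ m.sum = d := by
  simp only [partitionSet, Finset.mem_image, Finset.mem_univ, true_and]
  constructor
  · rintro ⟨p, rfl⟩
    exact ⟨fun x hx => p.parts_pos hx, p.parts_sum⟩
  · rintro ⟨h1, h2⟩
    exact ⟨⟨m, fun {x} hx => h1 x hx, h2⟩, rfl⟩

lemma card_partitionSet (d : ℕ) : (partitionSet d).card = numPartitions d := by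
  rw [partitionSet, Finset.card_image_of_injective _ fun p q h => Nat.Partition.ext h,
    Finset.card_univ, numPartitions]

/-- The number of distinct parts in all partitions of `d`. -/
lemma sum_card_toFinset_partitionSet (d : ℕ) :
    ∑ m ∈ partitionSet d, m.toFinset.card = ∑ i ∈ Finset.range d, numPartitions i := by
  simp only [← card_partitionSet]
  rw [← Finset.card_sigma, ← Finset.card_sigma]
  -- Removing one copy of a part `v` leaves a partition of `d - v < d`; conversely a partition of `i
  -- < d` is completed by the part `d - i`.
  refine Finset.card_bij' (fun x _ => ⟨d - x.2, x.1.erase x.2⟩)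
    (fun y _ => ⟨(d - y.1) ::ₘ y.2, d - y.1⟩) ?_ ?_ ?_ ?_
  · rintro ⟨m, v⟩ h
    simp only [Finset.mem_sigma, Multiset.mem_toFinset, mem_partitionSet, Finset.mem_range] at h ⊢
    obtain ⟨⟨hpos, hsum⟩, hv⟩ := h
    have h1 := Multiset.cons_erase hv
    have h2 : v + (m.erase v).sum = d := by rw [← Multiset.sum_cons, h1, hsum]
    have h3 := hpos v hv
    exact ⟨by omega, fun x hx => hpos x (Multiset.mem_of_mem_erase hx), by omega⟩
  · rintro ⟨i, m⟩ h
    simp only [Finset.mem_sigma, Multiset.mem_toFinset, mem_partitionSet, Finset.mem_range,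
      Multiset.mem_cons, Multiset.sum_cons] at h ⊢
    obtain ⟨hi, hpos, hsum⟩ := h
    refine ⟨⟨?_, by omega⟩, Or.inl trivial⟩
    rintro x (rfl | hx)
    · omega
    · exact hpos x hx
  · rintro ⟨m, v⟩ h
    simp only [Finset.mem_sigma, Multiset.mem_toFinset, mem_partitionSet] at h
    obtain ⟨⟨hpos, hsum⟩, hv⟩ := h
    have h1 := Multiset.cons_erase hv
    have h2 : v + (m.erase v).sum = d := by rw [← Multiset.sum_cons, h1, hsum]
    have h3 : d - (d - v) = v := by omega
    simp only [h3, h1]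
  · rintro ⟨i, m⟩ h
    simp only [Finset.mem_sigma, mem_partitionSet, Finset.mem_range] at h
    have h3 : d - (d - i) = i := by omega
    simp only [h3, Multiset.erase_cons_head]

lemma eq_replicate_of_count {i : ℕ} {m : Multiset ℕ} (hm : m ∈ partitionSet i)
    (h : i ≤ m.count 1) : m = Multiset.replicate i 1 := by
  obtain ⟨hpos, hsum⟩ := mem_partitionSet.1 hm
  obtain ⟨t, rfl⟩ := Multiset.le_iff_exists_add.1 (Multiset.le_count_iff_replicate_le.1 h)
  have : t.sum = 0 := by simpa using hsum
  have ht : t = 0 := by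
    refine Multiset.eq_zero_of_forall_notMem fun x hx => ?_
    have h1 := hpos x (Multiset.mem_add.2 (Or.inr hx))
    have h2 := Multiset.le_sum_of_mem hx
    omega
  rw [ht, add_zero]

lemma numPartitions_zero : numPartitions 0 = 1 := by decide

/-- For `j ≥ 2`, split the partitions of `i + j` by their number of ones. Adding a part `j` to a
partition of `i` gives fewer than `i` ones, except for the all-ones partition, which is sent to `{i
+ j}` instead. Adding `i` ones to a partition of `j` gives at least `i` ones. -/
lemma numPartitions_add_le {i j : ℕ} (hi : 1 ≤ i) (hj : 1 ≤ j) :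
    numPartitions i + numPartitions j ≤ numPartitions (i + j) := by
  wlog h2 : 2 ≤ j generalizing i j
  · by_cases hi2 : 2 ≤ i
    · have := this hj hi hi2
      rwa [add_comm, add_comm j] at this
    · obtain rfl : i = 1 := by omega
      obtain rfl : j = 1 := by omega
      have h1 : numPartitions 1 = 1 := by decide
      rw [h1, ← card_partitionSet]
      refine Finset.one_lt_card.2 ⟨{2}, mem_partitionSet.2 (by simp), {1, 1},
        mem_partitionSet.2 (by simp), fun h => ?_⟩
      have := congrArg Multiset.card h
      simp at this
  rw [← card_partitionSet, ← card_partitionSet, ← card_partitionSet,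
    ← Finset.card_filter_add_card_filter_not (s := partitionSet (i + j)) (fun m => m.count 1 < i)]
  refine Nat.add_le_add ?_ ?_
  · refine Finset.card_le_card_of_injOn
      (fun m => if m = Multiset.replicate i 1 then {i + j} else j ::ₘ m) ?_ ?_
    · intro m hm
      have hm' := mem_partitionSet.1 hm
      rw [Finset.mem_coe, Finset.mem_filter]
      beta_reduce
      split_ifs with h
      · refine ⟨mem_partitionSet.2 ⟨by simp; omega, by simp⟩, ?_⟩
        rw [Multiset.count_singleton, if_neg (by omega)]
        omega
      · refine ⟨mem_partitionSet.2 ⟨?_, by rw [Multiset.sum_cons, hm'.2, add_comm]⟩, ?_⟩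
        · intro x hx
          rcases Multiset.mem_cons.1 hx with rfl | hx
          · omega
          · exact hm'.1 x hx
        · rw [Multiset.count_cons_of_ne (by omega)]
          exact not_le.1 fun h' => h (eq_replicate_of_count hm h')
    · have key : ∀ m ∈ partitionSet i, ({i + j} : Multiset ℕ) ≠ j ::ₘ m := by
        intro m hm h
        have h1 := congrArg Multiset.card h
        rw [Multiset.card_singleton, Multiset.card_cons] at h1
        have h3 : m = 0 := Multiset.card_eq_zero.1 (by omega)
        have h4 := (mem_partitionSet.1 hm).2
        rw [h3, Multiset.sum_zero] at h4
        omega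
      intro m hm m' hm' h
      simp only at h
      split_ifs at h with h1 h2' h2'
      · rw [h1, h2']
      · exact absurd h (key m' hm')
      · exact absurd h.symm (key m hm)
      · exact (Multiset.cons_inj_right j).1 h
  · refine Finset.card_le_card_of_injOn (fun m => m + Multiset.replicate i 1) ?_ ?_
    · intro m hm
      have hm' := mem_partitionSet.1 hm
      rw [Finset.mem_coe, Finset.mem_filter, not_lt]
      beta_reduce
      refine ⟨mem_partitionSet.2 ⟨?_, by simp [hm'.2, add_comm]⟩, by simp⟩
      intro x hx
      rcases Multiset.mem_add.1 hx with hx | hx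
      · exact hm'.1 x hx
      · rw [Multiset.eq_of_mem_replicate hx]; exact one_pos
    · intro m _ m' _ h
      exact add_right_cancel h

/-- Pair `P(i)` with `P(d - i)`: superadditivity bounds the `d - 1` inner pairs by `P(d)`, and the
two outer ones equal `P(d) + 1`. -/
lemma two_mul_sum_numPartitions_le (d : ℕ) :
    2 * ∑ i ∈ Finset.range (d + 1), numPartitions i ≤ (d + 1) * numPartitions d + 2 := by
  have h1 := Finset.sum_range_reflect numPartitions (d + 1)
  have h2 : 2 * ∑ i ∈ Finset.range (d + 1), numPartitions i =
      ∑ i ∈ Finset.range (d + 1), (numPartitions i + numPartitions (d - i)) := by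
    rw [Finset.sum_add_distrib, two_mul]
    congr 1
    rw [← h1]
    exact Finset.sum_congr rfl fun i hi => by congr 1
  rw [h2]
  rcases Nat.eq_zero_or_pos d with rfl | hd
  · simp [numPartitions_zero]
  obtain ⟨e, rfl⟩ : ∃ e, d = e + 1 := ⟨d - 1, by omega⟩
  rw [Finset.sum_range_succ, Finset.sum_range_succ', Nat.sub_self, Nat.sub_zero, numPartitions_zero]
  have h3 : ∑ i ∈ Finset.range e, (numPartitions (i + 1) + numPartitions (e + 1 - (i + 1))) ≤
      e * numPartitions (e + 1) := by
    refine (Finset.sum_le_card_nsmul _ _ (numPartitions (e + 1)) fun i hi => ?_).trans (by simp)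
    have hi := Finset.mem_range.1 hi
    have := numPartitions_add_le (i := i + 1) (j := e + 1 - (i + 1)) (by omega) (by omega)
    rwa [show i + 1 + (e + 1 - (i + 1)) = e + 1 by omega] at this
  linarith

open Classical in
/-- The partitions of `d` whose Young subgroup in the symmetric group on `n` letters, where the
remaining letters have exponent zero, fixes a letter. -/
noncomputable def singletonPartitions (n d : ℕ) : Finset (Multiset ℕ) :=
  (partitionSet d).filter fun m => (∃ v ∈ m, m.count v = 1) ∨ m.card + 1 = n

lemma mem_singletonPartitions {n d : ℕ} {m : Multiset ℕ} : m ∈ singletonPartitions n d ↔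
    m ∈ partitionSet d ∧ ((∃ v ∈ m, m.count v = 1) ∨ m.card + 1 = n) := by
  simp only [singletonPartitions, Finset.mem_filter]

/-- Raising a largest part by one makes it the unique largest part, and this is injective. When `n =
d + 2`, the partition into `d + 1` ones leaves exactly one zero exponent; it is new, since the
others have a part at least 2. -/
lemma le_card_singletonPartitions (n d : ℕ) (hd : 1 ≤ d) :
    numPartitions d + (if n = d + 2 then 1 else 0) ≤ (singletonPartitions n (d + 1)).card := by
  let M : Multiset ℕ → ℕ := fun m => m.toFinset.sup id
  have hM : ∀ m ∈ partitionSet d, M m ∈ m := by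
    intro m hm
    have hne : m.toFinset.Nonempty := by
      rw [Multiset.toFinset_nonempty]
      rintro rfl
      have := (mem_partitionSet.1 hm).2
      simp at this
      omega
    obtain ⟨x, hx, hx'⟩ := Finset.exists_mem_eq_sup _ hne id
    have : M m = x := hx'
    rw [this]
    exact Multiset.mem_toFinset.1 hx
  have hle : ∀ m : Multiset ℕ, ∀ x ∈ m, x ≤ M m := fun m x hx =>
    Finset.le_sup (f := id) (Multiset.mem_toFinset.2 hx)
  let g : Multiset ℕ → Multiset ℕ := fun m => (M m + 1) ::ₘ m.erase (M m)
  have hgle : ∀ m, ∀ x ∈ g m, x ≤ M m + 1 := by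
    intro m x hx
    rcases Multiset.mem_cons.1 hx with rfl | hx
    · exact le_rfl
    · exact (hle m x (Multiset.mem_of_mem_erase hx)).trans (Nat.le_succ _)
  have hginj : Set.InjOn g (partitionSet d) := by
    intro m hm m' hm' h
    have h1 : M m + 1 ≤ M m' + 1 := hgle m' _ (h ▸ Multiset.mem_cons_self _ _)
    have h2 : M m' + 1 ≤ M m + 1 := hgle m _ (h ▸ Multiset.mem_cons_self _ _)
    have h3 : M m = M m' := by omega
    have h4 : (M m + 1) ::ₘ m.erase (M m) = (M m' + 1) ::ₘ m'.erase (M m') := h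
    rw [← h3] at h4
    have h5 := (Multiset.cons_inj_right _).1 h4
    rw [← Multiset.cons_erase (hM m hm), h5, Multiset.cons_erase (h3 ▸ hM m' hm')]
  have hgmem : ∀ m ∈ partitionSet d, g m ∈ singletonPartitions n (d + 1) := by
    intro m hm
    have hm' := mem_partitionSet.1 hm
    have h1 := Multiset.cons_erase (hM m hm)
    have h2 : M m + (m.erase (M m)).sum = d := by rw [← Multiset.sum_cons, h1, hm'.2]
    refine mem_singletonPartitions.2 ⟨mem_partitionSet.2 ⟨?_, ?_⟩, Or.inl ⟨M m + 1,
      Multiset.mem_cons_self _ _, ?_⟩⟩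
    · intro x hx
      rcases Multiset.mem_cons.1 hx with rfl | hx
      · omega
      · exact hm'.1 x (Multiset.mem_of_mem_erase hx)
    · simp only [g, Multiset.sum_cons]
      omega
    · simp only [g, Multiset.count_cons_self]
      rw [Multiset.count_eq_zero_of_notMem]
      intro hx
      have := hle m _ (Multiset.mem_of_mem_erase hx)
      omega
  have hcard : ((partitionSet d).image g).card = numPartitions d := by
    rw [Finset.card_image_of_injOn hginj, card_partitionSet]
  have hsub : (partitionSet d).image g ⊆ singletonPartitions n (d + 1) :=
    Finset.image_subset_iff.2 hgmem
  split_ifs with hn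
  · have hnot : Multiset.replicate (d + 1) 1 ∉ (partitionSet d).image g := by
      intro h
      obtain ⟨m, hm, h⟩ := Finset.mem_image.1 h
      have h1 : M m + 1 ∈ Multiset.replicate (d + 1) 1 := h ▸ Multiset.mem_cons_self _ _
      have h2 := Multiset.eq_of_mem_replicate h1
      have h3 := (mem_partitionSet.1 hm).1 _ (hM m hm)
      omega
    rw [← hcard, ← Finset.card_insert_of_notMem hnot]
    refine Finset.card_le_card (Finset.insert_subset (mem_singletonPartitions.2 ⟨mem_partitionSet.2
      ⟨fun x hx => ?_, by rw [Multiset.sum_replicate, smul_eq_mul, mul_one]⟩, Or.inr (by rw [Multiset.card_replicate, hn])⟩) hsub)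
    rw [Multiset.eq_of_mem_replicate hx]; exact one_pos
  · rw [add_zero, ← hcard]
    exact Finset.card_le_card hsub

/-- The excess `+ 2` in `two_mul_sum_numPartitions_le` is absorbed by `P(d - 1) ≥ 2` when `n > d +
1`, and by the extra all-ones partition when `n = d + 1`. -/
lemma two_mul_sum_numPartitions_le_card {n d : ℕ} (hd : 3 ≤ d) (hn : d < n) :
    2 * ∑ i ∈ Finset.range d, numPartitions i ≤ (n - 1) * (singletonPartitions n d).card := by
  obtain ⟨e, rfl⟩ : ∃ e, d = e + 1 := ⟨d - 1, by omega⟩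
  have h1 := two_mul_sum_numPartitions_le e
  have h2 := le_card_singletonPartitions n e (by omega)
  have h3 : 2 ≤ numPartitions e := by
    have ha := numPartitions_add_le (i := 1) (j := e - 1) le_rfl (by omega)
    have hb : numPartitions 1 = 1 := by decide
    have hc : 0 < numPartitions (e - 1) :=
      Fintype.card_pos_iff.2 ⟨Nat.Partition.indiscrete _⟩
    rw [show 1 + (e - 1) = e by omega] at ha
    omega
  refine h1.trans ?_
  split_ifs at h2 with hne
  · subst hne
    calc (e + 1) * numPartitions e + 2 ≤ (e + 1) * (numPartitions e + 1) := by nlinarith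
      _ ≤ _ := Nat.mul_le_mul (by omega) h2
  · calc (e + 1) * numPartitions e + 2 ≤ (e + 2) * (numPartitions e + 0) := by nlinarith
      _ ≤ _ := Nat.mul_le_mul (by omega) h2

end Partitions

end SymIdeal

namespace SymIdeal

open Equiv

/-! ### Monomials of degree `d`, their orbits and their shapes. -/

section Exponents

variable {n d : ℕ}

noncomputable instance exponentFintype (n d : ℕ) : Fintype (Exponent n d) :=
  Set.Finite.fintype (s := {a : Fin n →₀ ℕ | a.degree = d})
    ((Finsupp.finite_of_degree_le d).subset fun _ h => le_of_eq h)

/-- The right action of permutations on exponent vectors. -/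
noncomputable def actExp (σ : Perm (Fin n)) (a : Exponent n d) : Exponent n d :=
  ⟨Finsupp.equivMapDomain σ.symm a.1, by
    have h := a.2
    rw [Finsupp.degree_eq_sum] at h ⊢
    simp only [Finsupp.equivMapDomain_apply, symm_symm]
    exact (Equiv.sum_comp σ a.1).trans h⟩

lemma actExp_apply (σ : Perm (Fin n)) (a : Exponent n d) (x : Fin n) :
    (actExp σ a).1 x = a.1 (σ x) := by
  simp [actExp]

lemma exponent_ext {a b : Exponent n d} (h : ∀ x, a.1 x = b.1 x) : a = b :=
  Subtype.ext (Finsupp.ext h)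

lemma actExp_one (a : Exponent n d) : actExp 1 a = a :=
  exponent_ext fun x => by rw [actExp_apply]; rfl

lemma actExp_mul (σ τ : Perm (Fin n)) (a : Exponent n d) :
    actExp (σ * τ) a = actExp τ (actExp σ a) :=
  exponent_ext fun x => by simp only [actExp_apply, Perm.mul_apply]

/-- The nonzero exponents of a monomial. -/
def shape (a : Exponent n d) : Multiset ℕ :=
  ((Finset.univ : Finset (Fin n)).val.map a.1).filter (0 < ·)

lemma count_shape (a : Exponent n d) {v : ℕ} (hv : 0 < v) :
    (shape a).count v = (Finset.univ.filter fun x => a.1 x = v).card := by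
  rw [shape, Multiset.count_filter_of_pos hv, Multiset.count_map]
  simp only [eq_comm]
  rfl

lemma card_shape (a : Exponent n d) :
    (shape a).card + (Finset.univ.filter fun x => a.1 x = 0).card = n := by
  have h1 : (shape a).card = (Finset.univ.filter fun x => ¬ a.1 x = 0).card := by
    rw [shape, Multiset.filter_map, Multiset.card_map]
    simp only [← Nat.pos_iff_ne_zero]
    rfl
  rw [h1, add_comm, Finset.card_filter_add_card_filter_not, Finset.card_univ, Fintype.card_fin]

lemma mem_shape {a : Exponent n d} {v : ℕ} : v ∈ shape a ↔ 0 < v ∧ ∃ x, a.1 x = v := by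
  simp [shape, and_comm]

lemma shape_mem (a : Exponent n d) : shape a ∈ partitionSet d := by
  refine mem_partitionSet.2 ⟨fun x hx => (mem_shape.1 hx).1, ?_⟩
  have h1 := Multiset.filter_add_not (fun v => 0 < v)
    ((Finset.univ : Finset (Fin n)).val.map a.1)
  have h2 := congrArg Multiset.sum h1
  rw [Multiset.sum_add] at h2
  have h3 : (((Finset.univ : Finset (Fin n)).val.map a.1).filter fun v => ¬ 0 < v).sum = 0 := by
    refine Multiset.sum_eq_zero fun x hx => ?_
    have := (Multiset.mem_filter.1 hx).2
    omega
  rw [h3, add_zero] at h2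
  have h4 := a.2
  rw [Finsupp.degree_eq_sum] at h4
  exact h2.trans h4

/-- A partition of `d` has at most `d ≤ n` parts; pad it with zeros. -/
lemma exists_shape_eq (hn : d ≤ n) {m : Multiset ℕ} (hm : m ∈ partitionSet d) :
    ∃ a : Exponent n d, shape a = m := by
  obtain ⟨hpos, hsum⟩ := mem_partitionSet.1 hm
  have hcard : m.card ≤ n := by
    have := Multiset.card_nsmul_le_sum (s := m) (a := 1) (fun x hx => hpos x hx)
    rw [smul_eq_mul, mul_one, hsum] at this
    omega
  set l := (m + Multiset.replicate (n - m.card) 0).toList with hl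
  have hlen : l.length = n := by
    rw [hl, Multiset.length_toList, Multiset.card_add, Multiset.card_replicate]
    omega
  have hmap : (Finset.univ : Finset (Fin n)).val.map (fun i => l.get (i.cast hlen.symm)) =
      m + Multiset.replicate (n - m.card) 0 := by
    rw [Fin.univ_val_map, ← Multiset.coe_toList (m + _), ← hl]
    congr 1
    apply List.ext_get
    · simp [hlen]
    · intro i h1 h2
      simp
  refine ⟨⟨Finsupp.equivFunOnFinite.symm fun i => l.get (i.cast hlen.symm), ?_⟩, ?_⟩
  · have h2 := congrArg Multiset.sum hmap
    rw [Multiset.sum_add, Multiset.sum_replicate, smul_zero, add_zero, hsum] at h2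
    rw [Finsupp.degree_eq_sum]
    exact h2
  · change Multiset.filter _ (Multiset.map (fun i : Fin n => l.get (i.cast hlen.symm)) _) = m
    rw [hmap, Multiset.filter_add, Multiset.filter_eq_self.2 hpos, Multiset.filter_eq_nil.2,
      add_zero]
    intro x hx
    rw [Multiset.eq_of_mem_replicate hx]
    exact lt_irrefl 0

/-- Equal shapes have level sets of equal size, also at 0 because `n` is fixed; bijections of the
level sets glue to a permutation. -/
lemma exists_actExp_of_shape_eq {a b : Exponent n d} (h : shape a = shape b) :
    ∃ σ, b = actExp σ a := by
  have hcard : ∀ v, (Finset.univ.filter fun x => a.1 x = v).card =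
      (Finset.univ.filter fun x => b.1 x = v).card := by
    intro v
    rcases Nat.eq_zero_or_pos v with rfl | hv
    · have h1 := card_shape a
      have h2 := card_shape b
      rw [h] at h1
      omega
    · rw [← count_shape a hv, ← count_shape b hv, h]
  have hne : ∀ v, Nonempty ({x // b.1 x = v} ≃ {x // a.1 x = v}) := by
    intro v
    rw [← Fintype.card_eq, Fintype.card_subtype, Fintype.card_subtype, hcard]
  choose e he using fun v => (⟨Classical.choice (hne v), trivial⟩ :
    ∃ _ : {x // b.1 x = v} ≃ {x // a.1 x = v}, True)
  refine ⟨(sigmaFiberEquiv b.1).symm.trans ((sigmaCongrRight e).trans (sigmaFiberEquiv a.1)),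
    exponent_ext fun x => ?_⟩
  rw [actExp_apply]
  exact ((e (b.1 x)) ⟨x, rfl⟩).2.symm

/-- As `d < n`, the exponent 0 always occurs, so a monomial has one colour more than its shape has
distinct parts. -/
lemma image_exponent (hn : d < n) (a : Exponent n d) :
    Finset.univ.image a.1 = insert 0 (shape a).toFinset := by
  have h0 : ∃ x, a.1 x = 0 := by
    by_contra! h
    have h1 := a.2
    rw [Finsupp.degree_eq_sum] at h1
    have h2 : ∑ _x : Fin n, 1 ≤ ∑ x, a.1 x :=
      Finset.sum_le_sum fun x _ => Nat.one_le_iff_ne_zero.2 (h x)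
    simp at h2
    omega
  ext v
  simp only [Finset.mem_image, Finset.mem_univ, true_and, Finset.mem_insert,
    Multiset.mem_toFinset, mem_shape]
  constructor
  · rintro ⟨x, rfl⟩
    rcases Nat.eq_zero_or_pos (a.1 x) with hx | hx
    · exact Or.inl hx
    · exact Or.inr ⟨hx, x, rfl⟩
  · rintro (rfl | ⟨-, h⟩)
    · exact h0
    · exact h

lemma card_image_exponent (hn : d < n) (a : Exponent n d) :
    (Finset.univ.image a.1).card = (shape a).toFinset.card + 1 := by
  rw [image_exponent hn, Finset.card_insert_of_notMem]
  simp [mem_shape]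

lemma shape_actExp (σ : Perm (Fin n)) (a : Exponent n d) : shape (actExp σ a) = shape a := by
  have h1 : (Finset.univ : Finset (Fin n)).val.map (actExp σ a).1 =
      ((Finset.univ : Finset (Fin n)).val.map σ).map a.1 := by
    rw [Multiset.map_map]
    exact Multiset.map_congr rfl fun x _ => actExp_apply σ a x
  rw [shape, shape, h1, Multiset.map_univ_val_equiv]

lemma exists_singleton_of_mem {a : Exponent n d} (h : shape a ∈ singletonPartitions n d) :
    ∃ x, ∀ z, a.1 z = a.1 x → z = x := by
  have key : ∀ v, (Finset.univ.filter fun x => a.1 x = v).card = 1 →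
      ∃ x, ∀ z, a.1 z = a.1 x → z = x := by
    intro v hv
    obtain ⟨x, hx⟩ := Finset.card_eq_one.1 hv
    have hxv : a.1 x = v := by
      have := Finset.mem_singleton_self x
      rw [← hx] at this
      exact (Finset.mem_filter.1 this).2
    refine ⟨x, fun z hz => ?_⟩
    rw [← Finset.mem_singleton, ← hx]
    exact Finset.mem_filter.2 ⟨Finset.mem_univ z, hz.trans hxv⟩
  rcases (mem_singletonPartitions.1 h).2 with ⟨v, hv, hc⟩ | hc
  · exact key v (by rw [← count_shape a (mem_shape.1 hv).1, hc])
  · exact key 0 (by have := card_shape a; omega)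

end Exponents

end SymIdeal

namespace SymIdeal

open Equiv

/-! ### The multiplicity bound for nontrivial irreducibles. -/

section Irreducible

variable {K E : Type*} [Field K] [AddCommGroup E] [Module K E] [FiniteDimensional K E] {n d : ℕ}
  {ρ : Representation K (Perm (Fin n)) E} {W : Submodule K E}

lemma stable_iff_stable_onFinset_univ : Stable ρ W ↔ Stable (onFinset ρ Finset.univ) W := by
  rw [stable_onFinset_iff]
  constructor
  · intro h x _ y _ w hw
    exact h _ w hw
  · intro h g
    induction g using Perm.swap_induction_on with
    | one => intro w hw; rwa [map_one]
    | swap_mul f x y _ ih =>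
      intro w hw
      rw [map_mul, Module.End.mul_apply]
      exact h _ (Finset.mem_univ _) _ (Finset.mem_univ _) _ (ih w hw)

lemma Irred.onFinset_univ (h : Irred ρ W) : Irred (onFinset ρ Finset.univ) W :=
  ⟨stable_iff_stable_onFinset_univ.1 h.1, h.2.1, fun U hU hUs =>
    h.2.2 U hU (stable_iff_stable_onFinset_univ.2 hUs)⟩

/-- With at most two blocks, one of them a point, the Young subgroup contains a point stabilizer. -/
lemma finrank_fixedBy_eq_zero {a : Exponent n d} (hn : d < n)
    (h0 : ∀ y, W ⊓ invariantsOn ρ (Finset.univ.erase y) = ⊥)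
    (ha : shape a ∈ singletonPartitions n d) (ha1 : (shape a).toFinset.card ≤ 1) :
    Module.finrank K ↥(W ⊓ fixedBy ρ Finset.univ a.1) = 0 := by
  obtain ⟨x, hx⟩ := exists_singleton_of_mem ha
  have h1 : ((Finset.univ.erase x).image a.1).card ≤ 1 := by
    rw [image_erase_of_forall fun z _ => hx z,
      Finset.card_erase_of_mem (Finset.mem_image_of_mem _ (Finset.mem_univ _)),
      card_image_exponent hn]
    omega
  have h2 := Submodule.finrank_mono (inf_le_inf_left W
    (fixedBy_mono (ρ := ρ) (c := a.1) (Finset.erase_subset x Finset.univ)))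
  rw [fixedBy_eq_invariantsOn h1, h0, finrank_bot] at h2
  omega

/-- The multiplicity bound for a nontrivial irreducible representation. -/
lemma sum_finrank_fixedBy_le (hX : (n.factorial : K) ≠ 0) (hn : d < n) {r : ℕ} (hr : 1 ≤ r)
    (hS : ∑ i ∈ Finset.range d, numPartitions i ≤ r * (n - 1)) (hW : Irred ρ W)
    (h0 : W ⊓ invariantsOn ρ Finset.univ = ⊥) (a : Multiset ℕ → Exponent n d)
    (ha : ∀ m ∈ partitionSet d, shape (a m) = m) :
    ∑ m ∈ partitionSet d, Module.finrank K ↥(W ⊓ fixedBy ρ Finset.univ (a m).1) ≤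
      r * Module.finrank K W := by
  have hX' : ((Fintype.card (Fin n)).factorial : K) ≠ 0 := by rwa [Fintype.card_fin]
  have hWu := hW.onFinset_univ
  have hcol : ∀ m ∈ partitionSet d, (Finset.univ.image (a m).1).card = m.toFinset.card + 1 := by
    intro m hm
    rw [card_image_exponent hn, ha m hm]
  have hcu : (Finset.univ : Finset (Fin n)).card = n := Finset.card_fin n
  have hsum := sum_card_toFinset_partitionSet d
  set S := ∑ i ∈ Finset.range d, numPartitions i with hSdef
  set f := Module.finrank K W with hf
  by_cases hpt : ∀ y, W ⊓ invariantsOn ρ (Finset.univ.erase y) = ⊥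
  swap
  · push Not at hpt
    obtain ⟨y, hy⟩ := hpt
    obtain ⟨h1, h2⟩ := standard_bounds_onFinset hX' hWu h0 (Finset.mem_univ y) hy
    rw [hcu] at h1
    calc ∑ m ∈ partitionSet d, Module.finrank K ↥(W ⊓ fixedBy ρ Finset.univ (a m).1)
        ≤ ∑ m ∈ partitionSet d, m.toFinset.card := by
          refine Finset.sum_le_sum fun m hm => ?_
          have := h2 (a m).1
          rw [hcol m hm] at this
          omega
      _ ≤ r * f := by
          rw [hsum]
          exact hS.trans (Nat.mul_le_mul_left r (by omega))
  have hle : ∀ m, Module.finrank K ↥(W ⊓ fixedBy ρ Finset.univ (a m).1) ≤ f :=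
    fun m => Submodule.finrank_mono inf_le_left
  rcases Nat.eq_zero_or_pos d with rfl | hd
  · rw [Finset.sum_eq_zero]
    · exact Nat.zero_le _
    · intro m hm
      have hm0 : m = 0 := by
        have hm' := mem_partitionSet.1 hm
        refine Multiset.eq_zero_of_forall_notMem fun x hx => ?_
        have h1 := hm'.1 x hx
        have h2 := Multiset.le_sum_of_mem hx
        omega
      have h1 := hcol m hm
      rw [fixedBy_eq_invariantsOn (by rw [h1, hm0]; rfl), h0, finrank_bot]
  have hdm : ({d} : Multiset ℕ) ∈ partitionSet d := mem_partitionSet.2 (by simpa using hd)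
  have hd0 : Module.finrank K ↥(W ⊓ fixedBy ρ Finset.univ (a {d}).1) = 0 := by
    refine finrank_fixedBy_eq_zero hn hpt ?_ ?_
    · rw [ha _ hdm]
      exact mem_singletonPartitions.2 ⟨hdm, Or.inl ⟨d, by simp, by simp⟩⟩
    · rw [ha _ hdm]; simp
  -- For `d ≤ 2`, at most one partition besides `{d}` remains, and it contributes at most `dim W`.
  by_cases hd3 : d < 3
  · have hP : numPartitions d ≤ 2 := by
      have h1 : ∑ m ∈ partitionSet d, 1 ≤ ∑ m ∈ partitionSet d, m.toFinset.card := by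
        refine Finset.sum_le_sum fun m hm => ?_
        rw [Nat.one_le_iff_ne_zero, Finset.card_ne_zero, Multiset.toFinset_nonempty]
        rintro rfl
        have := (mem_partitionSet.1 hm).2
        simp at this
        omega
      rw [Finset.sum_const, smul_eq_mul, mul_one, card_partitionSet, hsum, hSdef] at h1
      refine h1.trans ?_
      have h2 : numPartitions 1 = 1 := by decide
      interval_cases d <;> simp [Finset.sum_range_succ, numPartitions_zero, h2]
    rw [← Finset.add_sum_erase _ _ hdm, hd0, zero_add]
    calc _ ≤ ((partitionSet d).erase {d}).card • f := Finset.sum_le_card_nsmul _ _ _ fun m _ => hle m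
      _ ≤ r * f := by
        rw [Finset.card_erase_of_mem hdm, card_partitionSet, smul_eq_mul]
        exact Nat.mul_le_mul_right _ (by omega)
  · have hA := two_mul_sum_numPartitions_le_card (by omega : 3 ≤ d) hn
    have hne : (Finset.univ : Finset (Fin n)).Nonempty := ⟨⟨0, by omega⟩, Finset.mem_univ _⟩
    -- The factor `n - 2` is weakened to `n - 3` to give all terms a common denominator; each
    -- partition with a singleton block saves a full `f`.
    have hterm : ∀ m ∈ partitionSet d,
        (n - 3) * Module.finrank K ↥(W ⊓ fixedBy ρ Finset.univ (a m).1) +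
          (if m ∈ singletonPartitions n d then f else 0) ≤ m.toFinset.card * f := by
      intro m hm
      have hm1 : 1 ≤ m.toFinset.card := by
        rw [Nat.one_le_iff_ne_zero, Finset.card_ne_zero, Multiset.toFinset_nonempty]
        rintro rfl
        have := (mem_partitionSet.1 hm).2
        simp at this
        omega
      split_ifs with hs
      · rw [← ha m hm] at hs
        obtain ⟨x, hx⟩ := exists_singleton_of_mem hs
        have := finrank_fixedBy_le_of_singleton_of_point_stabilizers hX' hWu.1
          (fun y _ => hpt y) (Finset.mem_univ x) fun z _ => hx z
        rw [hcu, hcol m hm] at this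
        obtain ⟨D, hD⟩ : ∃ D, m.toFinset.card = D + 1 := ⟨_, (Nat.sub_add_cancel hm1).symm⟩
        rw [hD] at this ⊢
        rw [show D + 1 + 1 - 2 = D by omega] at this
        rw [add_mul, one_mul]
        exact Nat.add_le_add_right this _
      · have := finrank_fixedBy_le_of_point_stabilizers hX' hWu.1 (fun y _ => hpt y) hne
          m.toFinset.card (a m).1 (hcol m hm)
        rw [hcu] at this
        rw [add_zero]
        exact (Nat.mul_le_mul_right _ (by omega)).trans this
    have htot := Finset.sum_le_sum hterm
    rw [Finset.sum_add_distrib, ← Finset.mul_sum, ← Finset.sum_mul, hsum, ← Finset.sum_filter,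
      Finset.sum_const, smul_eq_mul] at htot
    have hfil : (partitionSet d).filter (· ∈ singletonPartitions n d) = singletonPartitions n d := by
      ext m
      rw [Finset.mem_filter]
      exact ⟨fun h => h.2, fun h => ⟨(mem_singletonPartitions.1 h).1, h⟩⟩
    rw [hfil] at htot
    set U := ∑ m ∈ partitionSet d, Module.finrank K ↥(W ⊓ fixedBy ρ Finset.univ (a m).1)
    set A := (singletonPartitions n d).card
    obtain ⟨k, rfl⟩ : ∃ k, n = k + 4 := ⟨n - 4, by omega⟩
    rw [show k + 4 - 3 = k + 1 by omega] at htot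
    rw [show k + 4 - 1 = k + 3 by omega] at hA hS
    -- Here `n = k + 4`. Replacing `A` by means of `2 S ≤ (n - 1) A` turns `(n - 3) U + A f ≤ S f`
    -- into `(n - 1) (n - 3) U ≤ (n - 3) S f`, and `S ≤ r (n - 1)` finishes.
    have h1 : (k + 3) * ((k + 1) * U) + 2 * S * f ≤ (k + 3) * (S * f) := by
      calc _ ≤ (k + 3) * ((k + 1) * U) + (k + 3) * A * f :=
            Nat.add_le_add_left (Nat.mul_le_mul_right _ hA) _
        _ = (k + 3) * ((k + 1) * U + A * f) := by ring
        _ ≤ _ := Nat.mul_le_mul_left _ htot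
    have h2 : ((k + 3) * (k + 1)) * U ≤ ((k + 3) * (k + 1)) * (r * f) := by
      have h3 : (k + 3) * (S * f) = (k + 1) * (S * f) + 2 * S * f := by ring
      calc _ = (k + 3) * ((k + 1) * U) := by ring
        _ ≤ (k + 1) * (S * f) := by omega
        _ ≤ (k + 1) * (r * (k + 3) * f) :=
            Nat.mul_le_mul_left _ (Nat.mul_le_mul_right _ hS)
        _ = _ := by ring
    exact Nat.le_of_mul_le_mul_left h2 (by positivity)

end Irreducible

end SymIdeal

namespace SymIdeal

open Equiv

/-! ### The Reynolds operator. -/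

section Average

variable {K G E : Type*} [Field K] [Group G] [Fintype G] [AddCommGroup E] [Module K E]

/-- The Reynolds operator. -/
noncomputable def average (ρ : Representation K G E) : E →ₗ[K] E :=
  (Fintype.card G : K)⁻¹ • ∑ g : G, ρ g

variable {ρ : Representation K G E}

lemma average_apply (w : E) : average ρ w = (Fintype.card G : K)⁻¹ • ∑ g : G, ρ g w := by
  simp [average, LinearMap.sum_apply]

lemma average_mem {J : Submodule K E} (hJ : Stable ρ J) {w : E} (hw : w ∈ J) :
    average ρ w ∈ J := by
  rw [average_apply]
  exact J.smul_mem _ (J.sum_mem fun g _ => hJ g w hw)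

lemma average_of_fixed (hG : (Fintype.card G : K) ≠ 0) {w : E} (hw : ∀ g, ρ g w = w) :
    average ρ w = w := by
  rw [average_apply, Finset.sum_congr rfl fun g _ => hw g, Finset.sum_const, Finset.card_univ,
    ← Nat.cast_smul_eq_nsmul K, smul_smul, inv_mul_cancel₀ hG, one_smul]

lemma average_apply_apply (h : G) (w : E) : average ρ (ρ h w) = average ρ w := by
  rw [average_apply, average_apply, ← Equiv.sum_comp (Equiv.mulRight h) fun g => ρ g w]
  congr 1
  refine Finset.sum_congr rfl fun g _ => ?_
  rw [Equiv.coe_mulRight, map_mul, Module.End.mul_apply]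

lemma apply_average (h : G) (w : E) : ρ h (average ρ w) = average ρ w := by
  rw [average_apply, map_smul, map_sum, ← Equiv.sum_comp (Equiv.mulLeft h) fun g => ρ g w]
  congr 1
  refine Finset.sum_congr rfl fun g _ => ?_
  rw [Equiv.coe_mulLeft, map_mul, Module.End.mul_apply]

end Average

/-! ### The permutation representation on forms and the spans of orbits. -/

section Permutation

variable (K : Type*) [Field K] (n d : ℕ)

/-- The permutation representation on coefficient vectors of forms. -/
noncomputable def permRep : Representation K (Perm (Fin n)) (Exponent n d → K) where
  toFun σ := LinearMap.funLeft K K (actExp σ)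
  map_one' := by
    ext g a
    simp [LinearMap.funLeft, actExp_one]
  map_mul' σ τ := by
    ext g a
    simp [LinearMap.funLeft, actExp_mul]

variable {K n d}

lemma permRep_apply (σ : Perm (Fin n)) (g : Exponent n d → K) (a : Exponent n d) :
    permRep K n d σ g a = g (actExp σ a) := rfl

lemma permRep_single (σ : Perm (Fin n)) (a : Exponent n d) :
    permRep K n d σ (Pi.single (actExp σ a) 1) = Pi.single a 1 := by
  ext b
  rw [permRep_apply]
  by_cases h : b = a
  · rw [h, Pi.single_eq_same, Pi.single_eq_same]
  · rw [Pi.single_eq_of_ne h, Pi.single_eq_of_ne]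
    intro h'
    apply h
    have := congrArg (actExp σ⁻¹) h'
    rwa [← actExp_mul, ← actExp_mul, mul_inv_cancel, actExp_one, actExp_one] at this

lemma mem_invariantsOn_univ {E : Type*} [AddCommGroup E] [Module K E] [FiniteDimensional K E]
    {ρ : Representation K (Perm (Fin n)) E} {w : E} :
    w ∈ invariantsOn ρ Finset.univ ↔ ∀ σ, ρ σ w = w :=
  ⟨fun h _ => apply_of_mem_invariantsOn h fun x hx => absurd (Finset.mem_univ x) hx,
    fun h _ _ _ _ _ => h _⟩

/-- Invariant functions are the functions of the shape, and every partition of `d` is a shape. -/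
lemma finrank_invariantsOn_univ (hn : d ≤ n) :
    Module.finrank K (invariantsOn (permRep K n d) Finset.univ) = numPartitions d := by
  let κ : Exponent n d → partitionSet d := fun a => ⟨shape a, shape_mem a⟩
  have hκ : Function.Surjective κ := by
    rintro ⟨m, hm⟩
    obtain ⟨a, ha⟩ := exists_shape_eq hn hm
    exact ⟨a, Subtype.ext ha⟩
  have hrange : LinearMap.range (LinearMap.funLeft K K κ) =
      invariantsOn (permRep K n d) Finset.univ := by
    ext w
    rw [mem_invariantsOn_univ]
    constructor
    · rintro ⟨h, rfl⟩ σ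
      ext a
      rw [permRep_apply, LinearMap.funLeft_apply, LinearMap.funLeft_apply]
      congr 1
      exact Subtype.ext (shape_actExp σ a)
    · intro hw
      choose s hs using hκ
      refine ⟨w ∘ s, ?_⟩
      ext a
      rw [LinearMap.funLeft_apply, Function.comp_apply]
      obtain ⟨σ, hσ⟩ := exists_actExp_of_shape_eq (a := s (κ a)) (b := a)
        (congrArg Subtype.val (hs (κ a)))
      conv_rhs => rw [hσ]
      exact (congrFun (hw σ) (s (κ a))).symm
  rw [← hrange, LinearMap.finrank_range_of_inj (LinearMap.funLeft_injective_of_surjective K K κ hκ),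
    Module.finrank_fintype_fun_eq_card, Fintype.card_coe, card_partitionSet]

/-- Functions of the pair (shape, exponent of `y`) are fixed by the stabilizer of `y`. A shape
allows its distinct parts and 0 as exponent of `y`. -/
lemma le_finrank_invariantsOn_erase (hn : d < n) (y : Fin n) :
    ∑ i ∈ Finset.range d, numPartitions i + numPartitions d ≤
      Module.finrank K (invariantsOn (permRep K n d) (Finset.univ.erase y)) := by
  let T := (partitionSet d).sigma fun m => insert 0 m.toFinset
  have hT : T.card = ∑ i ∈ Finset.range d, numPartitions i + numPartitions d := by
    rw [Finset.card_sigma, ← sum_card_toFinset_partitionSet, ← card_partitionSet d,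
      Finset.card_eq_sum_ones, ← Finset.sum_add_distrib]
    refine Finset.sum_congr rfl fun m hm => Finset.card_insert_of_notMem fun h => ?_
    exact lt_irrefl 0 ((mem_partitionSet.1 hm).1 0 (Multiset.mem_toFinset.1 h))
  let κ : Exponent n d → T := fun a => ⟨⟨shape a, a.1 y⟩, Finset.mem_sigma.2 ⟨shape_mem a, by
    rw [← image_exponent hn]; exact Finset.mem_image_of_mem _ (Finset.mem_univ y)⟩⟩
  have hκ : Function.Surjective κ := by
    rintro ⟨⟨m, v⟩, h⟩
    obtain ⟨hm, hv⟩ := Finset.mem_sigma.1 h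
    obtain ⟨a, rfl⟩ := exists_shape_eq hn.le hm
    rw [← image_exponent hn] at hv
    obtain ⟨x, -, rfl⟩ := Finset.mem_image.1 hv
    refine ⟨actExp (swap y x) a, Subtype.ext ?_⟩
    simp only [κ, shape_actExp, actExp_apply, swap_apply_left]
  have hrange : LinearMap.range (LinearMap.funLeft K K κ) ≤
      invariantsOn (permRep K n d) (Finset.univ.erase y) := by
    rintro _ ⟨h, rfl⟩ p hp q hq -
    ext a
    rw [permRep_apply, LinearMap.funLeft_apply, LinearMap.funLeft_apply]
    congr 1
    refine Subtype.ext ?_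
    simp only [κ, shape_actExp, actExp_apply]
    rw [swap_apply_of_ne_of_ne (Finset.ne_of_mem_erase hp).symm (Finset.ne_of_mem_erase hq).symm]
  have := Submodule.finrank_mono hrange
  rwa [LinearMap.finrank_range_of_inj (LinearMap.funLeft_injective_of_surjective K K κ hκ),
    Module.finrank_fintype_fun_eq_card, Fintype.card_coe, hT] at this

/-- An equivariant map from the permutation representation is determined by its values at
representatives of the orbits. -/
lemma finrank_equivariantInto_le (W : Submodule K (Exponent n d → K)) (a : Multiset ℕ → Exponent n d)
    (ha : ∀ m ∈ partitionSet d, shape (a m) = m) :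
    Module.finrank K (equivariantInto (permRep K n d) W) ≤
      ∑ m ∈ partitionSet d,
        Module.finrank K ↥(W ⊓ fixedBy (permRep K n d) Finset.univ (a m).1) := by
  obtain ⟨F, hFdef⟩ : ∃ F : Multiset ℕ → Submodule K (Exponent n d → K), ∀ m, F m =
      W ⊓ fixedBy (permRep K n d) Finset.univ (a m).1 := ⟨_, fun _ => rfl⟩
  suffices h : Module.finrank K (equivariantInto (permRep K n d) W) ≤
      ∑ m ∈ partitionSet d, Module.finrank K (F m) by
    refine h.trans (Finset.sum_le_sum fun m _ => le_of_eq ?_)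
    rw [hFdef]
  -- Frobenius reciprocity: the image of a monomial is fixed by the Young subgroup stabilizing that
  -- monomial.
  have hF : ∀ (θ : equivariantInto (permRep K n d) W) m,
      (θ : (Exponent n d → K) →ₗ[K] _) (Pi.single (a m) 1) ∈ F m := by
    intro θ m
    rw [hFdef]
    refine ⟨θ.2.2 _, fun x _ y _ hxy => ?_⟩
    rw [← θ.2.1]
    congr 1
    have : actExp (swap x y) (a m) = a m := by
      refine exponent_ext fun z => ?_
      rw [actExp_apply, swap_apply_def]
      split_ifs with h1 h2
      · rw [h1, hxy]
      · rw [h2, hxy]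
      · rfl
    have h2 := permRep_single (K := K) (swap x y) (a m)
    rwa [this] at h2
  let ev : equivariantInto (permRep K n d) W →ₗ[K] ((m : partitionSet d) → F m) :=
    LinearMap.pi fun m => LinearMap.codRestrict (F m)
      ((LinearMap.applyₗ (Pi.single (a m) (1 : K) : Exponent n d → K)).comp (Submodule.subtype _)) fun θ => hF θ m
  have hev : Function.Injective ev := by
    intro θ θ' hθ
    refine Subtype.ext (LinearMap.pi_ext' fun b => LinearMap.ext_ring ?_)
    have hm := shape_mem b
    obtain ⟨σ, hσ⟩ := exists_actExp_of_shape_eq (a := b) (b := a (shape b)) (ha _ hm).symm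
    have h1 : (θ : (Exponent n d → K) →ₗ[K] (Exponent n d → K)) (Pi.single (a (shape b)) 1) =
        (θ' : (Exponent n d → K) →ₗ[K] (Exponent n d → K)) (Pi.single (a (shape b)) 1) :=
      congrArg Subtype.val (congrFun hθ ⟨shape b, hm⟩)
    change (θ : (Exponent n d → K) →ₗ[K] (Exponent n d → K)) (Pi.single b 1) =
      (θ' : (Exponent n d → K) →ₗ[K] (Exponent n d → K)) (Pi.single b 1)
    rw [← permRep_single σ b, ← hσ, θ.2.1, θ'.2.1, h1]
  have h1 := LinearMap.finrank_le_finrank_of_injective hev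
  rw [Module.finrank_pi_fintype] at h1
  rwa [← Finset.sum_coe_sort (partitionSet d) fun m => Module.finrank K ↥(F m)]

variable {r : ℕ}

/-- There are `r` linearly independent forms generating, together with the invariants, all forms. -/
lemma exists_generic_family (hX : (n.factorial : K) ≠ 0) (hn : d < n) (hr : 1 ≤ r)
    (hrd : r ≤ numPartitions d) (hS : ∑ i ∈ Finset.range d, numPartitions i ≤ r * (n - 1)) :
    ∃ f : Fin r → Exponent n d → K, LinearIndependent K f ∧
      ∀ J, Stable (permRep K n d) J → (∀ i, f i ∈ J) →
        Fintype.card (Exponent n d) + r ≤ Module.finrank K J + numPartitions d := by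
  have hG : (Fintype.card (Perm (Fin n)) : K) ≠ 0 := by
    rwa [Fintype.card_perm, Fintype.card_fin]
  set ρ := permRep K n d with hρ
  set I := invariantsOn ρ Finset.univ with hI
  have hIs : Stable ρ I := fun g w hw => by
    rw [mem_invariantsOn_univ.1 hw g]; exact hw
  have hIfin : Module.finrank K I = numPartitions d := finrank_invariantsOn_univ hn.le
  obtain ⟨N, -, hN, hIN, hIN'⟩ := exists_stable_compl hG hIs (N := ⊤)
    (fun _ _ _ => Submodule.mem_top) le_top
  have hfin := finrank_sup_of_disjoint hIN
  rw [hIN', finrank_top, Module.finrank_fintype_fun_eq_card, hIfin] at hfin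
  have : Nonempty (Exponent n d) :=
    ⟨(exists_shape_eq hn.le (mem_partitionSet.2 ⟨fun x hx => (Nat.Partition.indiscrete d).parts_pos hx,
      (Nat.Partition.indiscrete d).parts_sum⟩)).choose⟩
  choose! a ha using fun m (hm : m ∈ partitionSet d) => exists_shape_eq hn.le hm
  obtain ⟨v, hv, hgen⟩ := exists_generators hG r hN fun W hW hWi =>
    (finrank_equivariantInto_le W a ha).trans (sum_finrank_fixedBy_le hX hn hr hS hWi
      (inf_eq_bot_mono (by rw [inf_comm]; exact hIN) hW le_rfl) a ha)
  let s : Fin r → I := fun i => Module.finBasis K I (Fin.castLE (hrd.trans hIfin.ge) i)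
  have hs : LinearIndependent K s :=
    (Module.finBasis K I).linearIndependent.comp _ (Fin.castLE_injective _)
  have hs' : LinearIndependent K fun i => (s i : Exponent n d → K) :=
    hs.map' I.subtype (Submodule.ker_subtype I)
  -- Averaging `v i + s i` thus recovers `s i`, so a stable space containing the sum contains both
  -- terms.
  have hav : ∀ i, average ρ (v i) = 0 := by
    intro i
    have : average ρ (v i) ∈ I ⊓ N :=
      ⟨mem_invariantsOn_univ.2 fun g => apply_average g _, average_mem hN (hv i)⟩
    rw [hIN] at this
    simpa using this
  have has : ∀ i, average ρ (s i : Exponent n d → K) = s i := fun i =>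
    average_of_fixed hG (mem_invariantsOn_univ.1 (s i).2)
  have haf : ∀ i, average ρ (v i + s i) = s i := fun i => by rw [map_add, hav, has, zero_add]
  refine ⟨fun i => v i + s i, ?_, ?_⟩
  · refine LinearIndependent.of_comp (average ρ) ?_
    have : (average ρ ∘ fun i => v i + (s i : Exponent n d → K)) = fun i => (s i : Exponent n d → K) :=
      funext haf
    rwa [this]
  · intro J hJ hJf
    have hsJ : ∀ i, (s i : Exponent n d → K) ∈ J := fun i => haf i ▸ average_mem hJ (hJf i)
    have hNJ : N ≤ J := hgen J hJ fun i => by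
      have := J.sub_mem (hJf i) (hsJ i)
      rwa [add_sub_cancel_right] at this
    have hspan : Submodule.span K (Set.range fun i => (s i : Exponent n d → K)) ≤ I :=
      Submodule.span_le.2 (by rintro _ ⟨i, rfl⟩; exact (s i).2)
    have h1 := finrank_sup_of_disjoint (inf_eq_bot_mono hIN hspan (le_refl N))
    rw [finrank_span_eq_card hs', Fintype.card_fin] at h1
    have h2 : Submodule.span K (Set.range fun i => (s i : Exponent n d → K)) ⊔ N ≤ J :=
      sup_le (Submodule.span_le.2 (by rintro _ ⟨i, rfl⟩; exact hsJ i)) hNJ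
    have h3 := Submodule.finrank_mono h2
    omega

/-- The subspace spanned by the orbits of a family of vectors. -/
def orbitSpan {G E : Type*} [Group G] [AddCommGroup E] [Module K E] (ρ : Representation K G E)
    (f : Fin r → E) : Submodule K E :=
  Submodule.span K (Set.range fun p : G × Fin r => ρ p.1 (f p.2))

lemma stable_orbitSpan {G E : Type*} [Group G] [AddCommGroup E] [Module K E]
    {ρ : Representation K G E} (f : Fin r → E) : Stable ρ (orbitSpan ρ f) := by
  intro g w hw
  refine Submodule.span_induction ?_ ?_ ?_ ?_ hw
  · rintro _ ⟨p, rfl⟩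
    refine Submodule.subset_span ⟨(g * p.1, p.2), ?_⟩
    simp only [map_mul, Module.End.mul_apply]
  · rw [map_zero]; exact Submodule.zero_mem _
  · intro x y _ _ hx hy
    rw [map_add]; exact Submodule.add_mem _ hx hy
  · intro c x _ hx
    rw [map_smul]; exact Submodule.smul_mem _ _ hx

/-- The invariants of a subgroup in `orbitSpan` are spanned by averages. -/
lemma finrank_orbitSpan_inf_le {G E ι : Type*} [Group G] [AddCommGroup E] [Module K E]
    [FiniteDimensional K E] {ρ : Representation K G E} (f : Fin r → E) {F : Submodule K E}
    (e : E →ₗ[K] E) (he : ∀ w ∈ F, e w = w) [Fintype ι] (t : ι → E)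
    (ht : ∀ g i, ∃ j, e (ρ g (f i)) = t j) :
    Module.finrank K ↥(F ⊓ orbitSpan ρ f) ≤ Fintype.card ι := by
  refine le_trans (Submodule.finrank_mono ?_) (finrank_range_le_card (R := K) t)
  rintro w ⟨hwF, hw⟩
  rw [← he w hwF]
  have : orbitSpan ρ f ≤ (Submodule.span K (Set.range t)).comap e := by
    refine Submodule.span_le.2 ?_
    rintro _ ⟨p, rfl⟩
    obtain ⟨j, hj⟩ := ht p.1 p.2
    change e (ρ p.1 (f p.2)) ∈ Submodule.span K (Set.range t)
    rw [hj]
    exact Submodule.subset_span ⟨j, rfl⟩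
  exact this hw

lemma finrank_inf_fixedBy_eq {E : Type*} [AddCommGroup E] [Module K E] [FiniteDimensional K E]
    {ρ : Representation K (Perm (Fin n)) E} {A B : Submodule K E} (hA : Stable ρ A)
    (hB : Stable ρ B) (hAB : A ⊓ B = ⊥) (hAB' : A ⊔ B = ⊤) (Y : Finset (Fin n)) :
    Module.finrank K (invariantsOn ρ Y) ≤ Module.finrank K ↥(invariantsOn ρ Y ⊓ A) +
      Module.finrank K ↥(invariantsOn ρ Y ⊓ B) := by
  refine le_trans (Submodule.finrank_mono ?_) (Submodule.finrank_add_le_finrank_add_finrank _ _)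
  intro w hw
  have hw' : w ∈ A ⊔ B := hAB' ▸ Submodule.mem_top
  obtain ⟨a, ha, b, hb, rfl⟩ := Submodule.mem_sup.1 hw'
  have hres : ∀ {C : Submodule K E}, Stable ρ C → Stable (onFinset ρ Y) C :=
    fun hC => stable_onFinset_iff.2 fun _ _ _ _ w hw => hC _ w hw
  obtain ⟨h1, h2⟩ := fixedBy_additive (hres hA) (hres hB) hAB ha hb hw
  exact Submodule.add_mem_sup ⟨h1, ha⟩ ⟨h2, hb⟩

/-- The dimension of the span of the orbits of `r` forms is bounded above, and the bound can only be
attained if `r * (n - 1)` is large. -/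
lemma finrank_orbitSpan_bounds (hX : (n.factorial : K) ≠ 0) (hn : d < n)
    (f : Fin r → Exponent n d → K) :
    Module.finrank K (orbitSpan (permRep K n d) f) + numPartitions d ≤
      Fintype.card (Exponent n d) + r ∧
    (Module.finrank K (orbitSpan (permRep K n d) f) + numPartitions d =
      Fintype.card (Exponent n d) + r → ∑ i ∈ Finset.range d, numPartitions i ≤ r * (n - 1)) := by
  have hX' : ((Fintype.card (Fin n)).factorial : K) ≠ 0 := by rwa [Fintype.card_fin]
  have hG : (Fintype.card (Perm (Fin n)) : K) ≠ 0 := by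
    rwa [Fintype.card_perm, Fintype.card_fin]
  set ρ := permRep K n d with hρ
  set I := orbitSpan ρ f with hI
  have hIs : Stable ρ I := stable_orbitSpan f
  obtain ⟨U, -, hU, hIU, hIU'⟩ := exists_stable_compl hG hIs (N := ⊤)
    (fun _ _ _ => Submodule.mem_top) le_top
  have hfin := finrank_sup_of_disjoint hIU
  rw [hIU', finrank_top, Module.finrank_fintype_fun_eq_card] at hfin
  have hinv := finrank_inf_fixedBy_eq hIs hU hIU hIU' Finset.univ
  rw [finrank_invariantsOn_univ hn.le] at hinv
  have h1 : Module.finrank K ↥(invariantsOn ρ Finset.univ ⊓ I) ≤ r := by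
    have := finrank_orbitSpan_inf_le (ρ := ρ) f (F := invariantsOn ρ Finset.univ) (average ρ)
      (fun w hw => average_of_fixed hG (mem_invariantsOn_univ.1 hw)) (fun i => average ρ (f i))
      (fun g i => ⟨i, average_apply_apply g _⟩)
    rwa [Fintype.card_fin] at this
  have h2 : Module.finrank K ↥(invariantsOn ρ Finset.univ ⊓ U) ≤ Module.finrank K U :=
    Submodule.finrank_mono inf_le_right
  refine ⟨by omega, fun heq => ?_⟩
  have y : Fin n := ⟨0, by omega⟩
  set Y := (Finset.univ : Finset (Fin n)).erase y with hY
  have hinvY := finrank_inf_fixedBy_eq hIs hU hIU hIU' Y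
  have hlow := le_finrank_invariantsOn_erase (K := K) hn y
  rw [← hY, ← hρ] at hlow
  have h3 : Module.finrank K ↥(invariantsOn ρ Y ⊓ U) ≤ Module.finrank K U :=
    Submodule.finrank_mono inf_le_right
  -- The average of `ρ g (f i)` over the stabilizer of `y` depends on `g` only through `g⁻¹ y`.
  have h4 : Module.finrank K ↥(invariantsOn ρ Y ⊓ I) ≤ n * r := by
    have := finrank_orbitSpan_inf_le (ρ := ρ) f (F := invariantsOn ρ Y) (average (onFinset ρ Y))
      (fun w hw => average_of_fixed (card_perm_ne_zero hX' Y) fun g =>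
        apply_of_mem_invariantsOn hw fun x hx => Perm.ofSubtype_apply_of_not_mem g hx)
      (fun p : Fin n × Fin r => average (onFinset ρ Y) (ρ (swap y p.1) (f p.2))) (by
        intro g i
        refine ⟨(g⁻¹ y, i), ?_⟩
        have hτ : ∀ x, (g * swap y (g⁻¹ y)) x ≠ x → x ∈ Y := by
          intro x hx
          refine Finset.mem_erase.2 ⟨fun h => hx ?_, Finset.mem_univ x⟩
          rw [h, Perm.mul_apply, swap_apply_left]
          simp
        have hτ' : ∀ x, (g * swap y (g⁻¹ y)) x ∈ Y ↔ x ∈ Y := by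
          intro x
          by_cases hx : (g * swap y (g⁻¹ y)) x = x
          · rw [hx]
          · exact iff_of_true (hτ _ fun h => hx ((g * swap y (g⁻¹ y)).injective h)) (hτ x hx)
        have e : ρ g (f i) = onFinset ρ Y ((g * swap y (g⁻¹ y)).subtypePerm hτ')
            (ρ (swap y (g⁻¹ y)) (f i)) := by
          rw [onFinset, MonoidHom.comp_apply, Perm.ofSubtype_subtypePerm hτ' hτ,
            ← Module.End.mul_apply, ← map_mul, mul_assoc, swap_mul_self, mul_one]
        rw [e, average_apply_apply])
    rwa [Fintype.card_prod, Fintype.card_fin, Fintype.card_fin] at this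
  have h5 : n * r = r * (n - 1) + r := by
    obtain ⟨k, rfl⟩ : ∃ k, n = k + 1 := ⟨n - 1, by omega⟩
    rw [Nat.add_sub_cancel]; ring
  -- `∑_{i<d} P(i) + P(d) ≤ n r + dim U`, with `dim U = P(d) - r`.
  omega

end Permutation

end SymIdeal

namespace SymIdeal

open Equiv MvPolynomial

/-! ### From ideals to spans of coefficient vectors. -/

section Forms

variable {K : Type*} [Field K] {n d : ℕ}

/-- The coefficients of a polynomial at the monomials of degree `d`. -/
noncomputable def coeffVec (K : Type*) [Field K] (n d : ℕ) :
    MvPolynomial (Fin n) K →ₗ[K] (Exponent n d → K) :=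
  LinearMap.pi fun a => lcoeff K a.1

lemma coeffVec_apply (p : MvPolynomial (Fin n) K) (a : Exponent n d) :
    coeffVec K n d p a = coeff a.1 p := rfl

lemma eq_zero_of_coeffVec_eq_zero {p : MvPolynomial (Fin n) K}
    (hp : p ∈ homogeneousSubmodule (Fin n) K d) (h : coeffVec K n d p = 0) : p = 0 := by
  ext a
  rw [coeff_zero]
  by_cases ha : a.degree = d
  · exact congrFun h ⟨a, ha⟩
  · exact ((mem_homogeneousSubmodule _ _).1 hp).coeff_eq_zero ha

/-- The form of degree `d` with prescribed coefficients. -/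
noncomputable def formOf (g : Exponent n d → K) : MvPolynomial (Fin n) K :=
  ∑ a, monomial a.1 (g a)

lemma formOf_mem (g : Exponent n d → K) : formOf g ∈ homogeneousSubmodule (Fin n) K d :=
  Submodule.sum_mem _ fun a _ => (mem_homogeneousSubmodule _ _).2 (isHomogeneous_monomial _ a.2)

lemma coeffVec_formOf (g : Exponent n d → K) : coeffVec K n d (formOf g) = g := by
  classical
  funext a
  rw [coeffVec_apply, formOf, coeff_sum, Finset.sum_eq_single a]
  · rw [coeff_monomial, if_pos rfl]
  · intro b _ hb
    rw [coeff_monomial, if_neg fun h => hb (Subtype.ext h)]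
  · intro h
    exact absurd (Finset.mem_univ a) h

lemma finrank_map_coeffVec {W : Submodule K (MvPolynomial (Fin n) K)}
    (hW : W ≤ homogeneousSubmodule (Fin n) K d) :
    Module.finrank K (W.map (coeffVec K n d)) = Module.finrank K W := by
  rw [← LinearMap.range_domRestrict]
  refine LinearMap.finrank_range_of_inj ((injective_iff_map_eq_zero _).2 fun w hw => ?_)
  exact Subtype.ext (eq_zero_of_coeffVec_eq_zero (hW w.2) hw)

lemma finrank_homogeneousSubmodule :
    Module.finrank K (homogeneousSubmodule (Fin n) K d) = Fintype.card (Exponent n d) := by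
  have h : (homogeneousSubmodule (Fin n) K d).map (coeffVec K n d) = ⊤ :=
    eq_top_iff.2 fun g _ => ⟨formOf g, formOf_mem g, coeffVec_formOf g⟩
  rw [← finrank_map_coeffVec le_rfl, h, finrank_top, Module.finrank_fintype_fun_eq_card]

lemma coeffVec_rename (σ : Perm (Fin n)) (p : MvPolynomial (Fin n) K) :
    coeffVec K n d (rename σ p) = permRep K n d σ (coeffVec K n d p) := by
  funext a
  rw [permRep_apply, coeffVec_apply, coeffVec_apply,
    ← coeff_rename_mapDomain σ σ.injective p (actExp σ a).1]
  congr 1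
  ext x
  obtain ⟨y, rfl⟩ := σ.surjective x
  rw [Finsupp.mapDomain_apply σ.injective, actExp_apply]

/-- The degree `d` part of an ideal generated by forms of degree `d`. -/
lemma degreePart_span {S : Set (MvPolynomial (Fin n) K)}
    (hS : ∀ s ∈ S, s ∈ homogeneousSubmodule (Fin n) K d) :
    degreePart (Ideal.span S) d = Submodule.span K S := by
  apply le_antisymm
  · have key : ∀ p ∈ Ideal.span S, homogeneousComponent d p ∈ Submodule.span K S := by
      intro p hp
      induction hp using Submodule.closure_induction with
      | zero => rw [map_zero]; exact Submodule.zero_mem _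
      | add x y _ _ hx hy => rw [map_add]; exact Submodule.add_mem _ hx hy
      | smul_mem a s hs =>
        rw [a.as_sum, Finset.sum_smul, map_sum]
        refine Submodule.sum_mem _ fun m _ => ?_
        have hm : monomial m (coeff m a) • s ∈ homogeneousSubmodule (Fin n) K (m.degree + d) :=
          (mem_homogeneousSubmodule _ _).2
            ((isHomogeneous_monomial _ rfl).mul ((mem_homogeneousSubmodule _ _).1 (hS s hs)))
        rw [homogeneousComponent_of_mem hm]
        split_ifs with h
        · have h0 : m = 0 := (Finsupp.degree_eq_zero_iff m).1 (by omega)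
          rw [h0, smul_eq_mul, ← C_apply, ← smul_eq_C_mul]
          exact Submodule.smul_mem _ _ (Submodule.subset_span hs)
        · exact Submodule.zero_mem _
    rintro p ⟨hp, hp'⟩
    have := key p hp
    rwa [homogeneousComponent_of_mem hp', if_pos rfl] at this
  · exact Submodule.span_le.2 fun s hs => ⟨Ideal.subset_span hs, hS s hs⟩

lemma finrank_degreePart_symmetricIdeal {r : ℕ} {L : Submodule K (MvPolynomial (Fin n) K)}
    (hL : L ≤ homogeneousSubmodule (Fin n) K d) {f : Fin r → MvPolynomial (Fin n) K}
    (hf : Submodule.span K (Set.range f) = L) :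
    Module.finrank K (degreePart (symmetricIdeal L) d) =
      Module.finrank K (orbitSpan (permRep K n d) fun i => coeffVec K n d (f i)) := by
  have hS : ∀ s ∈ {g | ∃ σ : Perm (Fin n), ∃ f ∈ L, g = rename σ f},
      s ∈ homogeneousSubmodule (Fin n) K d := by
    rintro s ⟨σ, p, hp, rfl⟩
    exact (mem_homogeneousSubmodule _ _).2
      (((mem_homogeneousSubmodule _ _).1 (hL hp)).rename_isHomogeneous)
  rw [symmetricIdeal, degreePart_span hS, ← finrank_map_coeffVec (Submodule.span_le.2 hS),
    Submodule.map_span]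
  refine congrArg (fun W : Submodule K (Exponent n d → K) => Module.finrank K W) ?_
  apply le_antisymm
  · refine Submodule.span_le.2 ?_
    rintro _ ⟨_, ⟨σ, p, hp, rfl⟩, rfl⟩
    rw [SetLike.mem_coe, coeffVec_rename]
    refine stable_orbitSpan _ σ _ ?_
    rw [← hf] at hp
    have : Submodule.span K (Set.range f) ≤ (orbitSpan (permRep K n d)
        fun i => coeffVec K n d (f i)).comap (coeffVec K n d) := by
      refine Submodule.span_le.2 ?_
      rintro _ ⟨i, rfl⟩
      exact Submodule.subset_span ⟨(1, i), by simp⟩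
    exact this hp
  · refine Submodule.span_le.2 ?_
    rintro _ ⟨⟨σ, i⟩, rfl⟩
    refine Submodule.subset_span ⟨rename σ (f i), ⟨σ, f i, ?_, rfl⟩, coeffVec_rename σ _⟩
    exact hf ▸ Submodule.subset_span ⟨i, rfl⟩

end Forms

/-! ### Linear independence through minors. -/

section Minors

lemma exists_linearIndependent_fin_of_le {K V ι : Type*} [Field K] [AddCommGroup V] [Module K V]
    [Module.Finite K V] (w : ι → V) {M : ℕ} (h : M ≤ Module.finrank K (Submodule.span K (Set.range w))) :
    ∃ q : Fin M → ι, LinearIndependent K fun i => w (q i) := by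
  obtain ⟨g, hg, -, hli⟩ := Submodule.exists_fun_fin_finrank_span_eq K (Set.range w)
  choose q hq using hg
  refine ⟨fun i => q (Fin.castLE h i), ?_⟩
  simp only [hq]
  exact hli.comp _ (Fin.castLE_injective h)

variable {K : Type*} [Field K] {Ω : Type*} [Fintype Ω] {M : ℕ}

/-- Row rank equals column rank, so `M` independent columns can be selected. -/
lemma exists_minor_ne_zero {v : Fin M → Ω → K} (hv : LinearIndependent K v) :
    ∃ c : Fin M → Ω, (Matrix.of fun i j => v i (c j)).det ≠ 0 := by
  have hr : Module.finrank K (Submodule.span K (Set.range (Matrix.of v).col)) = M := by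
    rw [← Matrix.rank_eq_finrank_span_cols]
    simpa using LinearIndependent.rank_matrix (M := Matrix.of v) hv
  obtain ⟨c, hc⟩ := exists_linearIndependent_fin_of_le (K := K) (Matrix.of v).col hr.ge
  refine ⟨c, IsUnit.ne_zero ((Matrix.isUnit_iff_isUnit_det _).1 ?_)⟩
  exact Matrix.linearIndependent_cols_iff_isUnit.1 hc

lemma linearIndependent_of_minor_ne_zero {v : Fin M → Ω → K} {c : Fin M → Ω}
    (h : (Matrix.of fun i j => v i (c j)).det ≠ 0) : LinearIndependent K v :=
  LinearIndependent.of_comp (LinearMap.funLeft K K c)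
    (Matrix.linearIndependent_rows_iff_isUnit.2 ((Matrix.isUnit_iff_isUnit_det _).2 h.isUnit))

end Minors

/-! ### Vectors of a subspace whose entries are Plücker coordinates. -/

section PluckerRows

variable {K : Type*} [Field K] {Ω : Type*} {r : ℕ}

/-- The vectors of `r × r` minors with all columns but one fixed. -/
def pluckerRow (f : Fin r → Ω → K) (J : Fin r → Ω) (i : Fin r) (m : Ω) : K :=
  (Matrix.of fun k l => f k (Function.update J i m l)).det

/-- Cramer's rule for the matrix of the columns `J`. -/
lemma pluckerRow_eq (f : Fin r → Ω → K) (J : Fin r → Ω) (i : Fin r) :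
    pluckerRow f J i = ∑ k, (Matrix.of fun k l => f k (J l)).adjugate i k • f k := by
  funext m
  have h : (Matrix.of fun k l => f k (Function.update J i m l)) =
      (Matrix.of fun k l => f k (J l)).updateCol i fun k => f k m := by
    ext k l
    rw [Matrix.updateCol_apply, Matrix.of_apply, Matrix.of_apply, Function.update_apply]
    split_ifs <;> rfl
  rw [pluckerRow, h, ← Matrix.cramer_apply, Matrix.cramer_eq_adjugate_mulVec, Matrix.mulVec,
    dotProduct, Finset.sum_apply]
  rfl

/-- The minor at `J` may vanish here, so the inclusion is available at every point of the
Grassmannian. -/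
lemma pluckerRow_mem (f : Fin r → Ω → K) (J : Fin r → Ω) (i : Fin r) :
    pluckerRow f J i ∈ Submodule.span K (Set.range f) := by
  rw [pluckerRow_eq]
  exact Submodule.sum_mem _ fun k _ => Submodule.smul_mem _ _ (Submodule.subset_span ⟨k, rfl⟩)

/-- The relation `A * A.adjugate = A.det • 1` inverts `pluckerRow_eq`. -/
lemma mem_span_pluckerRow {f : Fin r → Ω → K} {J : Fin r → Ω}
    (hJ : (Matrix.of fun k l => f k (J l)).det ≠ 0) (k : Fin r) :
    f k ∈ Submodule.span K (Set.range (pluckerRow f J)) := by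
  set A : Matrix (Fin r) (Fin r) K := Matrix.of fun k l => f k (J l) with hA
  have h : ∑ i, A k i • pluckerRow f J i = A.det • f k := by
    simp only [pluckerRow_eq, ← hA, Finset.smul_sum, smul_smul]
    rw [Finset.sum_comm]
    simp only [← Finset.sum_smul, ← Matrix.mul_apply, Matrix.mul_adjugate]
    rw [Finset.sum_eq_single k]
    · simp
    · intro l _ hl
      simp [Matrix.one_apply_ne hl.symm]
    · simp
  rw [← inv_smul_smul₀ hJ (f k), ← h]
  exact Submodule.smul_mem _ _ (Submodule.sum_mem _ fun i _ =>
    Submodule.smul_mem _ _ (Submodule.subset_span ⟨i, rfl⟩))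

lemma orbitSpan_le {G E : Type*} [Group G] [AddCommGroup E] [Module K E]
    {ρ : Representation K G E} {f g : Fin r → E}
    (h : ∀ i, f i ∈ Submodule.span K (Set.range g)) : orbitSpan ρ f ≤ orbitSpan ρ g := by
  refine Submodule.span_le.2 ?_
  rintro _ ⟨⟨σ, i⟩, rfl⟩
  refine stable_orbitSpan g σ _ (Submodule.span_le.2 ?_ (h i))
  rintro _ ⟨j, rfl⟩
  exact Submodule.subset_span ⟨(1, j), by simp⟩

end PluckerRows

/-! ### Openness in the Zariski topology. -/

section Grassmannian

variable {K : Type*} [Field K] {n d r : ℕ}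

lemma isHomogeneous_det_X {σ : Type*} {M : ℕ} (s : Fin M → Fin M → σ) :
    (Matrix.of fun i j => (X (s i j) : MvPolynomial σ K)).det.IsHomogeneous M := by
  rw [Matrix.det_apply']
  refine IsHomogeneous.sum _ _ _ fun τ _ => ?_
  have h1 : (∏ i, (Matrix.of fun i j => (X (s i j) : MvPolynomial σ K)) (τ i) i).IsHomogeneous
      (∑ _i : Fin M, 1) := IsHomogeneous.prod _ _ _ fun i _ => isHomogeneous_X _ _
  have h2 : (((Equiv.Perm.sign τ : ℤ) : MvPolynomial σ K)).IsHomogeneous 0 := by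
    rw [← map_intCast (C : K →+* MvPolynomial σ K)]
    exact isHomogeneous_C _ _
  simpa using h2.mul h1

lemma linearIndependent_formOf {f : Fin r → Exponent n d → K} (hf : LinearIndependent K f) :
    LinearIndependent K fun i => formOf (f i) := by
  refine LinearIndependent.of_comp (coeffVec K n d) ?_
  have : (coeffVec K n d ∘ fun i => formOf (f i)) = f := funext fun i => coeffVec_formOf (f i)
  rwa [this]

/-- The point of the Grassmannian spanned by independent coefficient vectors. -/
noncomputable def spanPoint {f : Fin r → Exponent n d → K} (hf : LinearIndependent K f) :
    FormGrassmannian K n r d where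
  space := Submodule.span K (Set.range fun i => formOf (f i))
  le_forms := Submodule.span_le.2 (by rintro _ ⟨i, rfl⟩; exact formOf_mem _)
  finrank_eq := by
    rw [finrank_span_eq_card (linearIndependent_formOf hf), Fintype.card_fin]

lemma finrank_degreePart_of_basis (L : FormGrassmannian K n r d)
    (b : Module.Basis (Fin r) K L.space) :
    Module.finrank K (degreePart (symmetricIdeal L.space) d) =
      Module.finrank K (orbitSpan (permRep K n d)
        fun i => coeffVec K n d (b i : MvPolynomial (Fin n) K)) := by
  refine finrank_degreePart_symmetricIdeal L.le_forms
    (f := fun i => (b i : MvPolynomial (Fin n) K)) ?_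
  have h : (Set.range fun i => (b i : MvPolynomial (Fin n) K)) =
      L.space.subtype '' Set.range b := by
    rw [← Set.range_comp]; rfl
  rw [h, Submodule.span_image, b.span_eq, Submodule.map_top, Submodule.range_subtype]

/-- If the orbit of one `r`-dimensional space of forms spans a space of dimension at least `M`,
then so does the orbit of a general one. -/
lemma exists_isOpen_le_finrank_degreePart {M : ℕ} {f₀ : Fin r → Exponent n d → K}
    (hf₀ : LinearIndependent K f₀) (hM : M ≤ Module.finrank K (orbitSpan (permRep K n d) f₀)) :
    ∃ U : Set (FormGrassmannian K n r d), IsOpen U ∧ U.Nonempty ∧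
      ∀ L ∈ U, M ≤ Module.finrank K (degreePart (symmetricIdeal L.space) d) := by
  obtain ⟨J, hJ⟩ := exists_minor_ne_zero hf₀
  have hM' : M ≤ Module.finrank K (Submodule.span K (Set.range
      fun p : Perm (Fin n) × Fin r => permRep K n d p.1 (pluckerRow f₀ J p.2))) :=
    hM.trans (Submodule.finrank_mono (orbitSpan_le (mem_span_pluckerRow hJ)))
  obtain ⟨q, hq⟩ := exists_linearIndependent_fin_of_le _ hM'
  obtain ⟨c, hc⟩ := exists_minor_ne_zero hq
  -- Every entry of the nonzero `M × M` minor is a Plücker coordinate, with index `s i j`; hence the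
  -- minor is a form `F` of degree `M` in these coordinates.
  set s : Fin M → Fin M → Fin r → Exponent n d := fun i j =>
    Function.update J (q i).2 (actExp (q i).1 (c j)) with hs
  set F : MvPolynomial (Fin r → Exponent n d) K := (Matrix.of fun i j => X (s i j)).det with hF
  have heval : ∀ f : Fin r → MvPolynomial (Fin n) K, eval (pluckerCoord f) F =
      (Matrix.of fun i j => permRep K n d (q i).1
        (pluckerRow (fun k => coeffVec K n d (f k)) J (q i).2) (c j)).det := by
    intro f
    rw [hF, RingHom.map_det]
    congr 1
    ext i j
    rw [RingHom.mapMatrix_apply, Matrix.map_apply, Matrix.of_apply, Matrix.of_apply, eval_X]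
    rfl
  refine ⟨pluckerNonvanishing F, TopologicalSpace.isOpen_generateFrom_of_mem
    ⟨M, F, isHomogeneous_det_X s, rfl⟩, ⟨spanPoint hf₀,
      Module.Basis.span (linearIndependent_formOf hf₀), ?_⟩, ?_⟩
  · have h : eval (pluckerCoord fun i => formOf (f₀ i)) F ≠ 0 := by
      rw [heval]
      simp only [coeffVec_formOf]
      exact hc
    have e : (fun i => (Module.Basis.span (linearIndependent_formOf hf₀) i :
        MvPolynomial (Fin n) K)) = fun i => formOf (f₀ i) :=
      _root_.funext fun i => by rw [Module.Basis.span_apply (linearIndependent_formOf hf₀)]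
    exact (congrArg (fun g => eval (pluckerCoord g) F) e).trans_ne h
  · rintro L ⟨b, hb⟩
    rw [heval] at hb
    rw [finrank_degreePart_of_basis L b, ← Fintype.card_fin M,
      ← finrank_span_eq_card (linearIndependent_of_minor_ne_zero hb)]
    refine (Submodule.finrank_mono (Submodule.span_le.2 ?_)).trans
      (Submodule.finrank_mono (orbitSpan_le
        (pluckerRow_mem (fun i => coeffVec K n d (b i : MvPolynomial (Fin n) K)) J)))
    rintro _ ⟨i, rfl⟩
    exact Submodule.subset_span ⟨q i, rfl⟩

end Grassmannian

lemma natCast_factorial_ne_zero_of_lt_ringChar {K : Type*} [Field K] {n : ℕ}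
    (h : ringChar K = 0 ∨ n < ringChar K) : (n.factorial : K) ≠ 0 := by
  rw [Ne, ringChar.spec]
  intro hd
  rcases h with h | h
  · rw [h, zero_dvd_iff] at hd
    exact n.factorial_ne_zero hd
  · have hp : (ringChar K).Prime :=
      (CharP.char_is_prime_or_zero K (ringChar K)).resolve_right (by omega)
    exact absurd ((hp.dvd_factorial).1 hd) (by omega)

lemma le_iff_one_add_div_le {n r S : ℕ} (hr : 1 ≤ r) (hn : 1 ≤ n) :
    (1 : ℚ) + S / r ≤ n ↔ S ≤ r * (n - 1) := by
  have hr' : (0 : ℚ) < r := by exact_mod_cast hr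
  rw [← le_sub_iff_add_le', div_le_iff₀ hr', ← Nat.cast_one, ← Nat.cast_sub hn, mul_comm]
  exact_mod_cast Iff.rfl

end SymIdeal

theorem mainTheorem3 (K : Type*) [Field K] [Infinite K] (n d r : ℕ)
    (hchar : ringChar K = 0 ∨ n < ringChar K)
    (hr : 1 ≤ r) (hrd : r ≤ SymIdeal.numPartitions d) (hn : d < n) :
    SymIdeal.HoldsForGeneral K n r d fun I =>
      ((Module.finrank K (SymIdeal.degreePart I d) : ℤ) =
          (Module.finrank K (MvPolynomial.homogeneousSubmodule (Fin n) K d) : ℤ) -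
            ((SymIdeal.numPartitions d : ℤ) - (r : ℤ))) ↔
        (n : ℚ) ≥ 1 + (∑ i ∈ Finset.range d, (SymIdeal.numPartitions i : ℚ)) / (r : ℚ) := by
  open SymIdeal in
  have hX := natCast_factorial_ne_zero_of_lt_ringChar hchar
  have hdim : ∀ L : FormGrassmannian K n r d,
      Module.finrank K (degreePart (symmetricIdeal L.space) d) + numPartitions d ≤
          Fintype.card (Exponent n d) + r ∧
        (Module.finrank K (degreePart (symmetricIdeal L.space) d) + numPartitions d =
            Fintype.card (Exponent n d) + r →
          ∑ i ∈ Finset.range d, numPartitions i ≤ r * (n - 1)) := by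
    intro L
    have : Module.Finite K L.space :=
      Module.finite_of_finrank_pos (by rw [L.finrank_eq]; omega)
    rw [finrank_degreePart_of_basis L (Module.finBasisOfFinrankEq K L.space L.finrank_eq)]
    exact finrank_orbitSpan_bounds hX hn _
  have hcond : ((n : ℚ) ≥ 1 + (∑ i ∈ Finset.range d, (numPartitions i : ℚ)) / (r : ℚ)) ↔
      ∑ i ∈ Finset.range d, numPartitions i ≤ r * (n - 1) := by
    rw [← le_iff_one_add_div_le hr (by omega), ge_iff_le, Nat.cast_sum]
  unfold HoldsForGeneral
  simp only [hcond, finrank_homogeneousSubmodule]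
  by_cases hS : ∑ i ∈ Finset.range d, numPartitions i ≤ r * (n - 1)
  · obtain ⟨f₀, hf₀, hgen⟩ := exists_generic_family (K := K) hX hn hr hrd hS
    have h₀ := hgen (orbitSpan (permRep K n d) f₀) (stable_orbitSpan f₀)
      fun i => Submodule.subset_span ⟨(1, i), by simp⟩
    obtain ⟨U, hUo, hUn, hU⟩ := exists_isOpen_le_finrank_degreePart hf₀ le_rfl
    refine ⟨U, hUo, hUn, fun L hL => iff_of_true ?_ hS⟩
    have := (hdim L).1
    have := hU L hL
    omega
  -- When the inequality fails, no `L` attains the dimension, so the whole Grassmannian serves. It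
  -- is nonempty because `r ≤ P(d) ≤ dim R_d`.
  · have hle : r ≤ Module.finrank K
        (Submodule.span K (Set.range (id : (Exponent n d → K) → Exponent n d → K))) := by
      rw [Set.range_id, Submodule.span_univ, finrank_top]
      refine hrd.trans ?_
      rw [← finrank_invariantsOn_univ (K := K) hn.le]
      exact Submodule.finrank_le _
    obtain ⟨g, hg⟩ := exists_linearIndependent_fin_of_le _ hle
    refine ⟨Set.univ, isOpen_univ, ⟨spanPoint hg, trivial⟩, fun L _ => iff_of_false ?_ hS⟩
    intro h
    exact hS ((hdim L).2 (by omega))
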